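/- Let $\mathcal S$ be a finite or countable set and let $p=(p_{jk})_{j,k\in\mathcal S}$ be an irreducible and recurrent transition matrix with stationary measure $(m_j)_{j\in\mathcal S}$, where $0<m_j<\infty$ and $\sum_k m_kp_{kj}=m_j$ for all $j$. For $i\in\mathcal S$ let $\mathbb P_i$ be the law on $\mathcal S^{\mathbb Z}$ of the two-sided chain $X=(X_n)_{n\in\mathbb Z}$ with $X_0=i$, that is, $(X_n)_{n\ge0}$ and $(X_{-n})_{n\ge0}$ are independent Markov chains started in $i$ with transition matrices $p$ and $p^*_{jk}=(m_k/m_j)p_{kj}$, respectively; for a probability measure $\nu=(\nu_j)_{j\in\mathcal S}$ put $\mathbb P_\nu=\sum_j\nu_j\mathbb P_j$. Let $L^j(A)=\frac1{m_j}\#\{n\in A:X_n=j\}$ for $A\subset\mathbb Z$. Fix $i\in\mathcal S$ and a probability measure $\nu$ on $\mathcal S$ such that $\nu_i=0$ and $\frac{m_i}{m_j}\nu_j\in\mathbb Z$ for all $j\in\mathcal S$, and let $$T_*=\min\Big\{n\ge0:\ L^i([0,n])\le\sum_{j\in\mathcal S}\nu_j\,L^j([0,n])\Big\}.$$ Then $T_*<\infty$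 holds $\mathbb P_i$-almost surely, and the following is true. Let $(\mathbb Q_\omega)_{\omega\in\mathcal S^{\mathbb Z}}$ be a measurable family of probability measures on a measurable space $\Omega'$, let $\mathbb P_i^{\oplus}(d\omega\,d\omega')=\mathbb P_i(d\omega)\,\mathbb Q_\omega(d\omega')$ with expectation $\mathbb E_i^\oplus$, and let $T\colon\mathcal S^{\mathbb Z}\times\Omega'\to\{0,1,2,\dots\}$ be measurable and such that under $\mathbb P_i^\oplus$ the shifted process $(X_{n+T})_{n\in\mathbb Z}$ has law $\mathbb P_\nu$ (i.e. $T$ is a non-negative, possibly randomized, solution of the embedding problem). Then, for every concave function $\psi\colon\{0,1,2,\dots\}\to[0,\infty)$, $$\mathbb E_i[\psi(T_*)]\ \le\ \mathbb E_i^{\oplus}[\psi(T)],$$ where both sides take values in $[0,\infty]$. -/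

import Mathlib

open MeasureTheory ProbabilityTheory
open scoped ENNReal NNReal

namespace TwoSidedChain

noncomputable section

variable {S : Type*}

/-- The weights `m` are positive, finite and stationary for the transition matrix `p`
(row `i` of the matrix is the probability vector `p i`). -/
structure IsStationary (p : S → PMF S) (m : S → ℝ≥0) : Prop where
  pos : ∀ j, 0 < m j
  stationary : ∀ j, ∑' k, (m k : ℝ≥0∞) * p k j = m j

/-- The dual transition matrix `p*_{ij} = (m_j / m_i) p_{ji}`. -/
def dual (p : S → PMF S) (m : S → ℝ≥0) (hm : IsStationary p m) (i : S) : PMF S :=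
  ⟨fun j => (m j : ℝ≥0∞) / m i * p j i, by
    have h0 : (m i : ℝ≥0∞) ≠ 0 := by exact_mod_cast (hm.pos i).ne'
    have h : ∑' j, (m j : ℝ≥0∞) / m i * p j i = 1 := by
      have e : ∀ j, (m j : ℝ≥0∞) / m i * p j i = (m i : ℝ≥0∞)⁻¹ * (m j * p j i) := by
        intro j
        rw [div_eq_mul_inv]
        ring
      simp_rw [e]
      rw [ENNReal.tsum_mul_left, hm.stationary i,
        ENNReal.inv_mul_cancel h0 ENNReal.coe_ne_top]
    exact h ▸ ENNReal.summable.hasSum⟩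

/-- A forward and a backward trajectory, glued to a trajectory indexed by `ℤ`. -/
def glue (x : (ℕ → S) × (ℕ → S)) (n : ℤ) : S :=
  if 0 ≤ n then x.1 n.toNat else x.2 (-n).toNat

variable [MeasurableSpace S]

lemma measurable_glue : Measurable (glue : (ℕ → S) × (ℕ → S) → ℤ → S) := by
  refine measurable_pi_iff.2 fun n => ?_
  unfold glue
  split_ifs <;> fun_prop

variable [DiscreteMeasurableSpace S]

/-- The Markov kernel given by a transition matrix. -/
def stepKernel (p : S → PMF S) : Kernel S S := ⟨fun i => (p i).toMeasure, Measurable.of_discrete⟩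

instance (p : S → PMF S) : IsMarkovKernel (stepKernel p) :=
  ⟨fun i => PMF.toMeasure.isProbabilityMeasure (p i)⟩

/-- The law of the one-sided chain `(X_n : n ≥ 0)` with transition matrix `p` and `X_0 = i`. -/
def chainLaw (p : S → PMF S) (i : S) : Measure (ℕ → S) :=
  Kernel.traj (X := fun _ => S)
    (fun n => (stepKernel p).comap (fun x => x ⟨n, Finset.mem_Iic.2 le_rfl⟩) (measurable_pi_apply _))
    0 (fun _ => i)

instance (p : S → PMF S) (i : S) : IsProbabilityMeasure (chainLaw p i) := by
  unfold chainLaw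
  infer_instance

/-- Every state can be reached from every other one with positive probability. -/
def IsIrreducible (p : S → PMF S) : Prop :=
  ∀ i j, ∃ n : ℕ, 0 < chainLaw p i {x | x n = j}

/-- From every state, the chain returns to that state almost surely. -/
def IsRecurrent (p : S → PMF S) : Prop :=
  ∀ i, ∀ᵐ x ∂(chainLaw p i), ∃ n : ℕ, 0 < n ∧ x n = i

/-- The law `P_i` of the two-sided chain with transition matrix `p` and `X_0 = i`: given `X_0 = i`,
the forward chain `(X_n)` and the backward chain `(X_{-n})` are independent, with transition
matrices `p` and `p*`. -/
def twoSidedLaw (p : S → PMF S) (m : S → ℝ≥0) (hm : IsStationary p m) (i : S) :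
    Measure (ℤ → S) :=
  ((chainLaw p i).prod (chainLaw (dual p m hm) i)).map glue

instance (p : S → PMF S) (m : S → ℝ≥0) (hm : IsStationary p m) (i : S) :
    IsProbabilityMeasure (twoSidedLaw p m hm i) :=
  Measure.isProbabilityMeasure_map measurable_glue.aemeasurable

/-- The law `P_ν = ∑ ν_j P_j` of the two-sided chain with initial distribution `ν`. -/
def twoSidedLawOf (p : S → PMF S) (m : S → ℝ≥0) (hm : IsStationary p m) (ν : PMF S) :
    Measure (ℤ → S) :=
  Measure.sum fun j => ν j • twoSidedLaw p m hm j

/-- The law `P_i^⊕` of the two-sided chain started in `i` together with extra randomness, which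
given the trajectory `ω` has law `Q ω`. -/
def extendedLaw (p : S → PMF S) (m : S → ℝ≥0) (hm : IsStationary p m) (i : S)
    {Ω : Type*} [MeasurableSpace Ω] (Q : Kernel (ℤ → S) Ω) : Measure ((ℤ → S) × Ω) :=
  (twoSidedLaw p m hm i) ⊗ₘ Q

/-- The (possibly randomized) random time `T` solves the embedding problem for the chain started
in `i` and the target `ν`: `(X_{n+T} : n ∈ ℤ)` is the two-sided chain with initial
distribution `ν`. -/
structure IsEmbedding (p : S → PMF S) (m : S → ℝ≥0) (hm : IsStationary p m) (i : S) (ν : PMF S)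
    {Ω : Type*} [MeasurableSpace Ω] (Q : Kernel (ℤ → S) Ω) (T : (ℤ → S) × Ω → ℤ) : Prop where
  measurable : Measurable T
  law : (extendedLaw p m hm i Q).map (fun z n => z.1 (n + T z)) = twoSidedLawOf p m hm ν

/-- The local time `L^j(A) = #{n ∈ A : X_n = j} / m_j`. -/
def localTime (m : S → ℝ≥0) (ω : ℤ → S) (j : S) (A : Set ℤ) : ℝ≥0∞ :=
  ((A ∩ {n | ω n = j}).encard : ℝ≥0∞) / m j

/-- The time `T_* = min {n ≥ 0 : L^i([0,n]) ≤ ∑_j ν_j L^j([0,n])}`, with value `⊤` if there is no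
such `n`. -/
def Tstar (m : S → ℝ≥0) (i : S) (ν : PMF S) (ω : ℤ → S) : ℕ∞ :=
  sInf ((fun n : ℕ => (n : ℕ∞)) '' {n : ℕ |
    localTime m ω i (Set.Icc 0 (n : ℤ)) ≤ ∑' j, ν j * localTime m ω j (Set.Icc 0 (n : ℤ))})

end

/-- Concavity of a function on the non-negative integers: the increments are non-increasing. -/
def IsConcave (ψ : ℕ → ℝ) : Prop := ∀ n, ψ (n + 2) - ψ (n + 1) ≤ ψ (n + 1) - ψ n

end TwoSidedChain

/-! Put `κ j = m i * ν j / m j`, a natural number by assumption. After multiplication by `m i`, the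
time `Tstar` is the first `n` at which the integer charge "visits to `i` minus capacities `κ` of the
visited states" on `[0, n]` is no longer positive. The proof works under `μ = ∑ m_j P_j`, which is
shift-invariant, and for which `κ (X_n) μ` is `m i` times `P_ν` with its origin moved to time `n`.

Optimality: fix a window `[0, k)`, let `B l` say that the charge started at `l` is still positive at
the end of the window, and let `E n` be the union of the `B l` with `l ≤ n`. From each such `l` to
the next one the charge is a positive integer, so the number of these `l` is at most the charge
collected while `E n` holds (`sum_measure_add_lintegral_le`). On the other side, transport every
visit to `i` by `T`. A visit made while `E` holds either leaves the window or lands at a time at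
which `E` still holds, where the received mass is at most the capacity (`sum_measure_inter_le`). The
capacity terms are finite and cancel, and what remains is `E[min Tstar k] ≤ E[min T k]` for every
`k` (`sum_survival_le`). Summation by parts against the non-increasing, non-negative increments of
`ψ` turns this into the claim (`lintegral_concave_le`).

Finiteness: apply the same charge bound to the event `A` that the charge stays positive forever. By
recurrence, "`A` occurred in the past" agrees almost surely with "`A` recurs infinitely often in the
future", whose probability `h` is the same from every starting state. Averaging over a long window
gives `P_i(A) + h ≤ h` (`twoSidedLaw_iInter_survival`). -/

namespace TwoSidedChain

/-! ### One-sided path space -/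

section PathSpace

variable {S : Type*}

/-- The trajectories that agree with `y` up to time `n`. -/
def pathCylinder (n : ℕ) (y : ℕ → S) : Set (ℕ → S) := {x | ∀ k ≤ n, x k = y k}

lemma pathCylinder_eq_preimage (n : ℕ) (y : ℕ → S) :
    pathCylinder n y =
      Preorder.frestrictLe (π := fun _ => S) n ⁻¹' {Preorder.frestrictLe (π := fun _ => S) n y} := by
  ext x
  simp [pathCylinder, funext_iff]

/-- The trajectory that starts in `i` and continues with `x`. -/
def consPath (i : S) (x : ℕ → S) : ℕ → S
  | 0 => i
  | n + 1 => x n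

@[simp] lemma consPath_zero (i : S) (x : ℕ → S) : consPath i x 0 = i := rfl

@[simp] lemma consPath_succ (i : S) (x : ℕ → S) (n : ℕ) : consPath i x (n + 1) = x n := rfl

lemma measurable_consPath [MeasurableSpace S] (i : S) : Measurable (consPath i) := by
  refine measurable_pi_iff.2 fun n => ?_
  cases n with
  | zero => exact measurable_const
  | succ n => exact measurable_pi_apply n

lemma consPath_preimage_pathCylinder_succ (i : S) (n : ℕ) (y : ℕ → S) (h : y 0 = i) :
    consPath i ⁻¹' pathCylinder (n + 1) y = pathCylinder n (fun k => y (k + 1)) := by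
  ext x
  constructor
  · intro hx k hk
    exact hx (k + 1) (by omega)
  · rintro hx (_ | k) hk
    · exact h.symm
    · exact hx k (by omega)

end PathSpace

/-! ### The one-sided chain: first step, Markov property, recurrence -/

section ChainLaw

variable {S : Type*} [MeasurableSpace S] [DiscreteMeasurableSpace S]

lemma measurableSet_coord_eq {ι : Type*} (n : ι) (j : S) : MeasurableSet {x : ι → S | x n = j} :=
  (measurable_pi_apply n : Measurable fun x : ι → S => x n) (MeasurableSet.of_discrete (s := {j}))

lemma chainLaw_map_frestrictLe_prod (p : S → PMF S) (i : S) (n : ℕ) :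
    (chainLaw p i).map
        (fun x => (Preorder.frestrictLe (π := fun _ => S) n x, x (n + 1))) =
      ((chainLaw p i).map (Preorder.frestrictLe (π := fun _ => S) n)) ⊗ₘ
        ((stepKernel p).comap (fun x : (Finset.Iic n → S) => x ⟨n, Finset.mem_Iic.2 le_rfl⟩)
          (measurable_pi_apply _)) := by
  unfold chainLaw
  rw [Kernel.traj_map_frestrictLe_apply]
  exact (Kernel.partialTraj_compProd_eq_map_traj (X := fun _ => S) (Nat.zero_le n)).symm

lemma ae_chainLaw_zero (p : S → PMF S) (i : S) : ∀ᵐ x ∂chainLaw p i, x 0 = i := by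
  have h := Kernel.traj_map_frestrictLe_apply (X := fun _ => S)
    (κ := fun n => (stepKernel p).comap (fun x => x ⟨n, Finset.mem_Iic.2 le_rfl⟩)
      (measurable_pi_apply _)) 0 0 (fun _ => i)
  rw [Kernel.partialTraj_self, Kernel.id_apply] at h
  have h2 : ∀ᵐ z ∂(chainLaw p i).map (Preorder.frestrictLe (π := fun _ => S) 0),
      z ⟨0, by simp⟩ = i := by
    rw [chainLaw, h, ae_dirac_iff (measurableSet_coord_eq _ _)]
  exact ae_of_ae_map (by fun_prop) h2

lemma chainLaw_pathCylinder_succ (p : S → PMF S) [Countable S] (i : S) (n : ℕ) (y : ℕ → S) :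
    chainLaw p i (pathCylinder (n + 1) y) =
      chainLaw p i (pathCylinder n y) * p (y n) (y (n + 1)) := by
  have h := congrArg (fun μ : Measure ((Finset.Iic n → S) × S) =>
    μ ({Preorder.frestrictLe (π := fun _ => S) n y} ×ˢ {y (n + 1)}))
    (chainLaw_map_frestrictLe_prod p i n)
  beta_reduce at h
  rw [Measure.map_apply (by fun_prop) (MeasurableSet.of_discrete),
    Measure.compProd_apply_prod .of_discrete .of_discrete, Measure.restrict_singleton,
    lintegral_smul_measure, lintegral_dirac, Measure.map_apply (by fun_prop) .of_discrete,
    ← pathCylinder_eq_preimage, Kernel.comap_apply] at h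
  have e : (fun x => (Preorder.frestrictLe (π := fun _ => S) n x, x (n + 1))) ⁻¹'
      ({Preorder.frestrictLe (π := fun _ => S) n y} ×ˢ {y (n + 1)}) = pathCylinder (n + 1) y := by
    ext x
    simp only [Set.mem_preimage, Set.mem_prod, Set.mem_singleton_iff, funext_iff, pathCylinder,
      Set.mem_ofPred_eq, Nat.le_succ_iff]
    constructor
    · rintro ⟨h1, h2⟩ k (hk | rfl)
      · exact h1 ⟨k, Finset.mem_Iic.2 hk⟩
      · exact h2
    · exact fun h => ⟨fun k => h k (Or.inl (Finset.mem_Iic.1 k.2)), h _ (Or.inr rfl)⟩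
  rw [e] at h
  rw [h, smul_eq_mul]
  congr 1
  exact PMF.toMeasure_apply_singleton _ _ .of_discrete

open scoped Classical in
lemma chainLaw_pathCylinder [Countable S] (p : S → PMF S) (i : S) (n : ℕ) (y : ℕ → S) :
    chainLaw p i (pathCylinder n y) =
      (if y 0 = i then 1 else 0) * ∏ k ∈ Finset.range n, p (y k) (y (k + 1)) := by
  induction n with
  | zero =>
    have h := ae_chainLaw_zero p i
    by_cases hy : y 0 = i
    · have : chainLaw p i (pathCylinder 0 y) = chainLaw p i Set.univ := by
        refine measure_congr ?_
        filter_upwards [h] with x hx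
        refine propext ⟨fun _ => trivial, fun _ => ?_⟩
        intro k hk
        obtain rfl := Nat.le_zero.1 hk
        rw [hx, hy]
      simp [this, hy]
    · have : chainLaw p i (pathCylinder 0 y) = 0 := by
        refine measure_eq_zero_iff_ae_notMem.2 (h.mono fun x hx' hx => hy ?_)
        exact (hx 0 le_rfl).symm.trans hx'
      simp [this, hy]
  | succ n ih => rw [chainLaw_pathCylinder_succ, ih, Finset.prod_range_succ, mul_assoc]

/-- Since `S` is countable, the law of an initial segment is determined by its atoms. Every finite
set of times lies in an initial segment, so uniqueness of projective limits applies. -/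
lemma measure_ext_of_pathCylinder [Countable S] {μ ν : Measure (ℕ → S)} [IsFiniteMeasure μ]
    [IsFiniteMeasure ν] (h : ∀ n y, μ (pathCylinder n y) = ν (pathCylinder n y)) : μ = ν := by
  by_cases hS : IsEmpty S
  · have : IsEmpty (ℕ → S) := ⟨fun x => hS.elim (x 0)⟩
    exact Measure.ext fun s _ => by simp [Set.eq_empty_of_isEmpty s]
  rw [not_isEmpty_iff] at hS
  have key : ∀ n, μ.map (Preorder.frestrictLe (π := fun _ => S) n) =
      ν.map (Preorder.frestrictLe (π := fun _ => S) n) := by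
    intro n
    refine Measure.ext_of_singleton fun a => ?_
    obtain ⟨s⟩ := hS
    classical
    have ha : a = Preorder.frestrictLe (π := fun _ => S) n
        (fun k => if hk : k ≤ n then a ⟨k, Finset.mem_Iic.2 hk⟩ else s) := by
      ext k
      have := Finset.mem_Iic.1 k.2
      simp [this]
    rw [Measure.map_apply (by fun_prop) .of_discrete, Measure.map_apply (by fun_prop) .of_discrete,
      ha, ← pathCylinder_eq_preimage, h]
  have hν : IsProjectiveLimit ν (fun I : Finset ℕ => ν.map (I.restrict (π := fun _ => S))) :=
    fun _ => rfl
  refine IsProjectiveLimit.unique (fun I => ?_) hν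
  have hI := I.subset_Iic_sup_id
  have e : (I.restrict (π := fun _ => S)) =
      (Finset.restrict₂ (π := fun _ => S) hI) ∘ (Preorder.frestrictLe (π := fun _ => S) _) := rfl
  rw [e, ← Measure.map_map (by fun_prop) (by fun_prop), key, Measure.map_map (by fun_prop)
    (by fun_prop)]

lemma measurableSet_pathCylinder [Countable S] (n : ℕ) (y : ℕ → S) :
    MeasurableSet (pathCylinder n y) := by
  rw [pathCylinder_eq_preimage]
  exact (by fun_prop : Measurable (Preorder.frestrictLe (π := fun _ => S) n)) .of_discrete

/-- First-step decomposition of the law of the chain. -/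
theorem chainLaw_eq_sum [Countable S] (p : S → PMF S) (i : S) :
    chainLaw p i = Measure.sum fun j => p i j • (chainLaw p j).map (consPath i) := by
  have hprob : IsProbabilityMeasure
      (Measure.sum fun j => p i j • (chainLaw p j).map (consPath i)) := by
    constructor
    have : ∀ j, IsProbabilityMeasure ((chainLaw p j).map (consPath i)) := fun j =>
      Measure.isProbabilityMeasure_map (measurable_consPath i).aemeasurable
    simp [PMF.tsum_coe]
  refine measure_ext_of_pathCylinder fun n y => ?_
  classical
  rw [Measure.sum_apply _ (measurableSet_pathCylinder n y)]
  simp only [Measure.smul_apply, smul_eq_mul,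
    Measure.map_apply (measurable_consPath i) (measurableSet_pathCylinder n y)]
  by_cases hy : y 0 = i
  · cases n with
    | zero =>
      have : consPath i ⁻¹' pathCylinder 0 y = Set.univ := by
        ext x
        simp [pathCylinder, hy]
      simp [this, chainLaw_pathCylinder, hy, PMF.tsum_coe]
    | succ n =>
      rw [tsum_eq_single (y 1), consPath_preimage_pathCylinder_succ i n y hy,
        chainLaw_pathCylinder, chainLaw_pathCylinder, Finset.prod_range_succ']
      · simp [hy, mul_comm]
      · intro j hj
        rw [consPath_preimage_pathCylinder_succ i n y hy, chainLaw_pathCylinder]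
        simp [hj.symm]
  · have : consPath i ⁻¹' pathCylinder n y = ∅ := by
      ext x
      simp only [Set.mem_preimage, Set.mem_empty_iff_false, iff_false]
      exact fun hx => hy (hx 0 (Nat.zero_le _)).symm
    simp [this, chainLaw_pathCylinder, hy]

lemma chainLaw_apply_eq_tsum [Countable S] (p : S → PMF S) (i : S) {C : Set (ℕ → S)}
    (hC : MeasurableSet C) :
    chainLaw p i C = ∑' j, p i j * chainLaw p j (consPath i ⁻¹' C) := by
  conv_lhs => rw [chainLaw_eq_sum, Measure.sum_apply _ hC]
  simp [Measure.map_apply (measurable_consPath i) hC]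

/-- The Markov property at time `n`, for an event `D` that depends only on the states up to time
`n` and is contained in `{x | x n = k}`. -/
theorem chainLaw_markov [Countable S] (p : S → PMF S) (n : ℕ) (k : S) {C : Set (ℕ → S)}
    (hC : MeasurableSet C) (j : S) (D : Set (ℕ → S)) (hD : MeasurableSet D)
    (hdep : ∀ x y, (∀ r ≤ n, x r = y r) → x ∈ D → y ∈ D) (hk : ∀ x ∈ D, x n = k) :
    chainLaw p j (D ∩ (fun x r => x (n + r)) ⁻¹' C) = chainLaw p j D * chainLaw p k C := by
  induction n generalizing j D with
  | zero =>
    have h := ae_chainLaw_zero p j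
    simp only [Nat.zero_add]
    change chainLaw p j (D ∩ C) = _
    -- At time `0` the event `D` depends on the initial state alone, so it has probability `1` or
    -- `0`.
    by_cases hj : ∃ x ∈ D, x 0 = j
    · obtain ⟨x, hx, rfl⟩ := hj
      obtain rfl := hk x hx
      have hD' : ∀ᵐ y ∂chainLaw p (x 0), y ∈ D := by
        filter_upwards [h] with y hy
        refine hdep x y (fun r hr => ?_) hx
        obtain rfl := Nat.le_zero.1 hr
        exact hy.symm
      rw [(prob_compl_eq_zero_iff hD).1 hD', one_mul]
      refine measure_congr ?_
      filter_upwards [hD'] with y hy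
      exact propext ⟨fun h => h.2, fun h => ⟨hy, h⟩⟩
    · have hD' : chainLaw p j D = 0 :=
        measure_eq_zero_iff_ae_notMem.2 (h.mono fun x hx' hx => hj ⟨x, hx, hx'⟩)
      rw [hD', zero_mul]
      exact measure_mono_null Set.inter_subset_left hD'
  | succ n ih =>
    have hm : Measurable fun (x : ℕ → S) r => x (n + 1 + r) := by fun_prop
    rw [chainLaw_apply_eq_tsum p j (hD.inter (hm hC)), chainLaw_apply_eq_tsum p j hD,
      ← ENNReal.tsum_mul_right]
    refine tsum_congr fun l => ?_
    have := ih l (consPath j ⁻¹' D) (measurable_consPath j hD)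
      (fun x y hxy hx => hdep _ _ (fun r hr => by
        cases r with
        | zero => rfl
        | succ r => exact hxy r (by omega)) hx)
      (fun x hx => hk _ hx)
    rw [mul_assoc, ← this, Set.preimage_inter, ← Set.preimage_comp]
    congr 4
    ext x r
    simp only [Function.comp]
    rw [show n + 1 + r = (n + r) + 1 by omega, consPath_succ]

variable [Countable S] {p : S → PMF S}

/-- A recurrent chain returns to its starting point infinitely often. -/
lemma IsRecurrent.ae_frequently (hrec : IsRecurrent p) (i : S) :
    ∀ᵐ x ∂chainLaw p i, ∀ N : ℕ, ∃ n, N ≤ n ∧ x n = i := by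
  set C : Set (ℕ → S) := {x | ¬ ∃ n : ℕ, 0 < n ∧ x n = i}
  have hC : MeasurableSet C := by
    have : C = ⋂ n : ℕ, {x | 0 < n → ¬ x n = i} := by ext x; simp [C]
    rw [this]
    refine MeasurableSet.iInter fun n => ?_
    by_cases hn : 0 < n
    · simp only [hn, true_imp_iff]
      exact (measurableSet_coord_eq n i).compl
    · simp [hn]
  have h0 : chainLaw p i C = 0 := hrec i
  -- The Markov property at time `n` bounds the probability that `n` is the last visit by a multiple
  -- of the probability of no return, which is zero.
  have hlast : ∀ n : ℕ, ∀ᵐ x ∂chainLaw p i, ¬ (x n = i ∧ ∀ r, 0 < r → x (n + r) ≠ i) := by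
    intro n
    have := chainLaw_markov p n i hC i {x | x n = i} (measurableSet_coord_eq n i)
      (fun x y hxy hx => (hxy n le_rfl).symm.trans hx) (fun x hx => hx)
    rw [h0, mul_zero] at this
    refine measure_mono_null ?_ this
    intro x hx
    simp only [Set.mem_compl_iff, Set.mem_ofPred_eq, not_not] at hx
    refine ⟨hx.1, ?_⟩
    rintro ⟨r, hr, hr'⟩
    exact hx.2 r hr hr'
  rw [← ae_all_iff] at hlast
  filter_upwards [hlast, ae_chainLaw_zero p i] with x hx h0 N
  induction N with
  | zero => exact ⟨0, le_rfl, h0⟩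
  | succ N ih =>
    obtain ⟨n, hn, hxn⟩ := ih
    have := hx n
    push Not at this
    obtain ⟨r, hr, hr'⟩ := this hxn
    exact ⟨n + r, by omega, hr'⟩

/-- An irreducible recurrent chain hits every state almost surely. -/
lemma IsRecurrent.ae_exists_eq (hrec : IsRecurrent p) (hirr : IsIrreducible p) (i j : S) :
    ∀ᵐ x ∂chainLaw p j, ∃ n : ℕ, x n = i := by
  obtain ⟨n, hn⟩ := hirr i j
  set C : Set (ℕ → S) := {x | ¬ ∃ n : ℕ, x n = i}
  have hC : MeasurableSet C := by
    have : C = ⋂ n : ℕ, {x | x n = i}ᶜ := by ext x; simp [C]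
    rw [this]
    exact MeasurableSet.iInter fun n => (measurableSet_coord_eq n i).compl
  have := chainLaw_markov p n j hC i {x | x n = j} (measurableSet_coord_eq n j)
      (fun x y hxy hx => (hxy n le_rfl).symm.trans hx) (fun x hx => hx)
  -- Started in `i`, the chain returns to `i` after any time, so being in `j` at time `n` and
  -- avoiding `i` from then on has probability zero. As `j` is reached with positive probability,
  -- the second Markov factor must vanish.
  have h0 : chainLaw p i ({x | x n = j} ∩ (fun x r => x (n + r)) ⁻¹' C) = 0 := by
    refine measure_eq_zero_iff_ae_notMem.2 ((hrec.ae_frequently i).mono fun x hx' hx => hx.2 ?_)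
    obtain ⟨r, hr, hr'⟩ := hx' n
    exact ⟨r - n, (congrArg x (by omega : n + (r - n) = r)).trans hr'⟩
  rw [h0] at this
  exact (mul_eq_zero.1 this.symm).resolve_left hn.ne'

/-- The probability of a shift-invariant event does not depend on the starting point of an
irreducible recurrent chain. -/
lemma chainLaw_eq_of_invariant (hrec : IsRecurrent p) (hirr : IsIrreducible p) {C : Set (ℕ → S)}
    (hC : MeasurableSet C) (hinv : ∀ (n : ℕ) (x : ℕ → S), (fun r => x (n + r)) ∈ C ↔ x ∈ C)
    (i j : S) : chainLaw p j C = chainLaw p i C := by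
  -- Decomposition by the first hitting time of `i`, at which the chain restarts from `i` while an
  -- invariant event is unaffected.
  set D : ℕ → Set (ℕ → S) := fun n => {x | x n = i ∧ ∀ r < n, x r ≠ i}
  have hDm : ∀ n, MeasurableSet (D n) := by
    intro n
    have : D n = {x | x n = i} ∩ ⋂ r : Fin n, {x | x r = i}ᶜ := by
      ext x
      simp [D, Fin.forall_iff]
    rw [this]
    exact (measurableSet_coord_eq n i).inter
      (MeasurableSet.iInter fun r => (measurableSet_coord_eq _ i).compl)
  have hdisj : Pairwise (Function.onFun Disjoint D) := by
    intro a b hab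
    refine Set.disjoint_left.2 fun x hxa hxb => ?_
    rcases lt_or_gt_of_ne hab with h | h
    · exact hxb.2 a h hxa.1
    · exact hxa.2 b h hxb.1
  have hcover : ∀ᵐ x ∂chainLaw p j, x ∈ ⋃ n, D n := by
    classical
    filter_upwards [hrec.ae_exists_eq hirr i j] with x hx
    exact Set.mem_iUnion.2 ⟨Nat.find hx, Nat.find_spec hx, fun r hr => Nat.find_min hx hr⟩
  have hsum : ∑' n, chainLaw p j (D n) = 1 := by
    rw [← measure_iUnion hdisj hDm]
    exact (prob_compl_eq_zero_iff (MeasurableSet.iUnion hDm)).1 hcover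
  calc chainLaw p j C = chainLaw p j (⋃ n, D n ∩ C) := by
        refine measure_congr ?_
        filter_upwards [hcover] with x hx
        rw [← Set.iUnion_inter]
        exact propext ⟨fun h => ⟨hx, h⟩, fun h => h.2⟩
    _ = ∑' n, chainLaw p j (D n ∩ C) :=
        measure_iUnion (fun a b hab => (hdisj hab).mono Set.inter_subset_left Set.inter_subset_left)
          fun n => (hDm n).inter hC
    _ = ∑' n, chainLaw p j (D n) * chainLaw p i C := by
        refine tsum_congr fun n => ?_
        rw [← chainLaw_markov p n i hC j (D n) (hDm n) _ fun x hx => hx.1]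
        · congr 2
          ext x
          exact (hinv n x).symm
        · intro x y hxy hx
          exact ⟨hxy n le_rfl ▸ hx.1, fun r hr => hxy r hr.le ▸ hx.2 r hr⟩
    _ = chainLaw p i C := by rw [ENNReal.tsum_mul_right, hsum, one_mul]

end ChainLaw

/-! ### Shifts of two-sided trajectories -/

section Shift

variable {S : Type*}

/-- The shift by `l` of a two-sided trajectory. -/
def shift (l : ℤ) (ω : ℤ → S) : ℤ → S := fun n => ω (n + l)

@[simp] lemma shift_apply (l : ℤ) (ω : ℤ → S) (n : ℤ) : shift l ω n = ω (n + l) := rfl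

lemma shift_shift (a b : ℤ) (ω : ℤ → S) : shift a (shift b ω) = shift (a + b) ω := by
  ext n
  simp [add_assoc]

@[simp] lemma shift_zero (ω : ℤ → S) : shift 0 ω = ω := by
  ext n
  simp

@[fun_prop] lemma measurable_shift [MeasurableSpace S] (l : ℤ) :
    Measurable (shift l : (ℤ → S) → ℤ → S) :=
  measurable_pi_iff.2 fun n => measurable_pi_apply (n + l)

/-- The trajectory from time `0` on. -/
def forward (ω : ℤ → S) : ℕ → S := fun n => ω n

@[fun_prop] lemma measurable_forward [MeasurableSpace S] :
    Measurable (forward : (ℤ → S) → ℕ → S) :=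
  measurable_pi_iff.2 fun n => measurable_pi_apply (n : ℤ)

lemma forward_glue (x : (ℕ → S) × (ℕ → S)) : forward (glue x) = x.1 := by
  ext n
  simp [forward, glue]

/-- One time step moves the state `i` from the front of the forward path to the backward path. The
hypothesis on `y 0` is needed at time `-1`; the state `j` is arbitrary because `glue` reads time `0`
from the forward path. -/
lemma shift_glue_consPath {i : S} (j : S) (x : ℕ → S) {y : ℕ → S} (hy : y 0 = i) :
    shift 1 (glue (consPath i x, y)) = glue (x, consPath j y) := by
  ext n
  simp only [shift_apply, glue]
  rcases lt_trichotomy n (-1) with h | rfl | h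
  · rw [if_neg (by omega), if_neg (by omega)]
    obtain ⟨k, rfl⟩ : ∃ k : ℕ, n = -(k + 2 : ℕ) := ⟨(-n - 2).toNat, by omega⟩
    rw [show (-(-((k + 2 : ℕ) : ℤ))).toNat = (k + 1) + 1 by omega,
      show (-(-((k + 2 : ℕ) : ℤ) + 1)).toNat = k + 1 by omega, consPath_succ]
  · simp [hy]
  · obtain ⟨k, rfl⟩ : ∃ k : ℕ, n = k := ⟨n.toNat, by omega⟩
    rw [if_pos (by omega), if_pos (by omega), show ((k : ℤ) + 1).toNat = k + 1 by omega]
    simp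

end Shift

/-! ### The shift-invariant measure on two-sided trajectories -/

section Stationary

variable {S : Type*} [MeasurableSpace S] [DiscreteMeasurableSpace S]
  (p : S → PMF S) (m : S → ℝ≥0) (hm : IsStationary p m)

/-- The shift-invariant measure `∑ m_j P_j` on two-sided trajectories. -/
noncomputable def stationaryLaw : Measure (ℤ → S) :=
  Measure.sum fun j => (m j : ℝ≥0∞) • twoSidedLaw p m hm j

lemma lintegral_stationaryLaw (g : (ℤ → S) → ℝ≥0∞) :
    ∫⁻ ω, g ω ∂stationaryLaw p m hm = ∑' j, m j * ∫⁻ ω, g ω ∂twoSidedLaw p m hm j := by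
  simp only [stationaryLaw, lintegral_sum_measure, lintegral_smul_measure, smul_eq_mul]

lemma stationaryLaw_apply {s : Set (ℤ → S)} (hs : MeasurableSet s) :
    stationaryLaw p m hm s = ∑' j, m j * twoSidedLaw p m hm j s := by
  simp [stationaryLaw, Measure.sum_apply _ hs]

lemma map_forward_twoSidedLaw (j : S) :
    (twoSidedLaw p m hm j).map forward = chainLaw p j := by
  rw [twoSidedLaw, Measure.map_map measurable_forward measurable_glue]
  have : forward ∘ glue = (Prod.fst : (ℕ → S) × (ℕ → S) → ℕ → S) := by
    ext1 x
    exact forward_glue x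
  rw [this, Measure.map_fst_prod, measure_univ, one_smul]

lemma ae_twoSidedLaw_forward (j : S) {P : (ℕ → S) → Prop} (h : ∀ᵐ x ∂chainLaw p j, P x) :
    ∀ᵐ ω ∂twoSidedLaw p m hm j, P (forward ω) := by
  rw [← map_forward_twoSidedLaw p m hm j] at h
  exact ae_of_ae_map measurable_forward.aemeasurable h

lemma ae_twoSidedLaw_zero (j : S) : ∀ᵐ ω ∂twoSidedLaw p m hm j, ω 0 = j :=
  ae_twoSidedLaw_forward p m hm j (ae_chainLaw_zero p j)

lemma ae_twoSidedLaw_of_ae_stationaryLaw {P : (ℤ → S) → Prop}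
    (h : ∀ᵐ ω ∂stationaryLaw p m hm, P ω) (j : S) : ∀ᵐ ω ∂twoSidedLaw p m hm j, P ω := by
  have h1 : (m j : ℝ≥0∞) • twoSidedLaw p m hm j ≤ stationaryLaw p m hm := Measure.le_sum _ j
  have h2 := h.filter_mono (ae_mono h1)
  rwa [Measure.ae_ennreal_smul_measure_eq (by exact_mod_cast (hm.pos j).ne')] at h2

/-- The measure `∑ m_j P_j` restricted to `{X_0 = i}` is `m_i P_i`. -/
lemma setLIntegral_stationaryLaw (i : S) (g : (ℤ → S) → ℝ≥0∞) :
    ∫⁻ ω in {ω | ω 0 = i}, g ω ∂stationaryLaw p m hm =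
      m i * ∫⁻ ω, g ω ∂twoSidedLaw p m hm i := by
  have hs := measurableSet_coord_eq (0 : ℤ) i
  rw [← lintegral_indicator hs, lintegral_stationaryLaw, tsum_eq_single i]
  · congr 1
    refine lintegral_congr_ae ?_
    filter_upwards [ae_twoSidedLaw_zero p m hm i] with ω hω
    exact Set.indicator_of_mem (s := {ω : ℤ → S | ω 0 = i}) hω g
  · intro j hj
    rw [lintegral_eq_zero_of_ae_eq_zero, mul_zero]
    filter_upwards [ae_twoSidedLaw_zero p m hm j] with ω hω
    refine Set.indicator_of_notMem (s := {ω : ℤ → S | ω 0 = i}) (fun h => hj ?_) g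
    exact hω.symm.trans h

lemma stationaryLaw_inter (i : S) {s : Set (ℤ → S)} (hs : MeasurableSet s) :
    stationaryLaw p m hm (s ∩ {ω | ω 0 = i}) = m i * twoSidedLaw p m hm i s := by
  have := setLIntegral_stationaryLaw p m hm i (s.indicator 1)
  rwa [lintegral_indicator_one hs, lintegral_indicator_one hs, Measure.restrict_apply hs] at this

lemma map_shift_glue_cons (i j : S) :
    (((chainLaw p j).map (consPath i)).prod (chainLaw (dual p m hm) i)).map
      (shift 1 ∘ glue) =
    ((chainLaw p j).prod ((chainLaw (dual p m hm) i).map (consPath j))).map glue := by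
  have h1 : ((chainLaw p j).map (consPath i)).prod (chainLaw (dual p m hm) i) =
      ((chainLaw p j).prod (chainLaw (dual p m hm) i)).map (Prod.map (consPath i) id) := by
    rw [← Measure.map_prod_map _ _ (measurable_consPath i) measurable_id, Measure.map_id]
  have h2 : (chainLaw p j).prod ((chainLaw (dual p m hm) i).map (consPath j)) =
      ((chainLaw p j).prod (chainLaw (dual p m hm) i)).map (Prod.map id (consPath j)) := by
    rw [← Measure.map_prod_map _ _ measurable_id (measurable_consPath j), Measure.map_id]
  have hci := measurable_consPath i
  have hcj := measurable_consPath j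
  rw [h1, h2, Measure.map_map ((measurable_shift 1).comp measurable_glue) (by fun_prop),
    Measure.map_map measurable_glue (by fun_prop)]
  refine Measure.map_congr ?_
  have hy : ∀ᵐ z ∂(chainLaw p j).prod (chainLaw (dual p m hm) i), z.2 0 = i :=
    Measure.quasiMeasurePreserving_snd.ae (ae_chainLaw_zero (dual p m hm) i)
  filter_upwards [hy] with z hy
  exact shift_glue_consPath j z.1 hy

variable [Countable S]

/-- Decompose the shifted law by the forward step from `i` to `j`, and the unshifted law by the
backward step from `j` to `i`. The pieces coincide, and so do their weights, because `m i * p i j =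
m j * dual p m hm j i`. -/
lemma map_shift_one_stationaryLaw :
    (stationaryLaw p m hm).map (shift 1) = stationaryLaw p m hm := by
  have hL : ∀ i, (twoSidedLaw p m hm i).map (shift 1) = Measure.sum fun j => p i j •
      ((chainLaw p j).prod ((chainLaw (dual p m hm) i).map (consPath j))).map glue := by
    intro i
    rw [twoSidedLaw, Measure.map_map (measurable_shift 1) measurable_glue, chainLaw_eq_sum p i,
      Measure.prod_sum_left, Measure.map_sum ((measurable_shift 1).comp measurable_glue).aemeasurable]
    congr 1
    ext1 j
    rw [Measure.prod_smul_left, Measure.map_smul, map_shift_glue_cons]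
  have hR : ∀ j, twoSidedLaw p m hm j = Measure.sum fun i => dual p m hm j i •
      ((chainLaw p j).prod ((chainLaw (dual p m hm) i).map (consPath j))).map glue := by
    intro j
    conv_lhs => rw [twoSidedLaw, chainLaw_eq_sum (dual p m hm) j]
    rw [Measure.prod_sum_right, Measure.map_sum measurable_glue.aemeasurable]
    congr 1
    ext1 i
    rw [Measure.prod_smul_right, Measure.map_smul]
  refine Measure.ext fun s hs => ?_
  rw [Measure.map_apply (measurable_shift 1) hs, stationaryLaw_apply _ _ _ hs,
    stationaryLaw_apply _ _ _ (measurable_shift 1 hs)]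
  have hL' : ∀ i, twoSidedLaw p m hm i (shift 1 ⁻¹' s) = ∑' j, p i j *
      ((chainLaw p j).prod ((chainLaw (dual p m hm) i).map (consPath j))).map glue s := by
    intro i
    rw [← Measure.map_apply (measurable_shift 1) hs, hL, Measure.sum_apply _ hs]
    simp only [Measure.smul_apply, smul_eq_mul]
  have hR' : ∀ j, twoSidedLaw p m hm j s = ∑' i, dual p m hm j i *
      ((chainLaw p j).prod ((chainLaw (dual p m hm) i).map (consPath j))).map glue s := by
    intro j
    rw [hR, Measure.sum_apply _ hs]
    simp only [Measure.smul_apply, smul_eq_mul]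
  simp_rw [hL', hR', ← ENNReal.tsum_mul_left]
  rw [ENNReal.tsum_comm]
  refine tsum_congr fun j => tsum_congr fun i => ?_
  rw [← mul_assoc, ← mul_assoc]
  congr 1
  change _ = (m j : ℝ≥0∞) * ((m i : ℝ≥0∞) / m j * p i j)
  rw [← mul_assoc, ENNReal.mul_div_cancel (by exact_mod_cast (hm.pos j).ne') ENNReal.coe_ne_top]

/-- The measure `∑ m_j P_j` is invariant under all shifts. -/
theorem measurePreserving_shift (l : ℤ) :
    MeasurePreserving (shift l) (stationaryLaw p m hm) (stationaryLaw p m hm) := by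
  have h1 : MeasurePreserving (shift 1) (stationaryLaw p m hm) (stationaryLaw p m hm) :=
    ⟨measurable_shift 1, map_shift_one_stationaryLaw p m hm⟩
  have hneg : MeasurePreserving (shift (-1)) (stationaryLaw p m hm) (stationaryLaw p m hm) := by
    refine ⟨measurable_shift _, ?_⟩
    conv_lhs => rw [← h1.map_eq]
    rw [Measure.map_map (measurable_shift _) (measurable_shift _)]
    have : (shift (-1) ∘ shift 1 : (ℤ → S) → ℤ → S) = id := by
      ext1 ω
      simp [shift_shift]
    rw [this, Measure.map_id]
  induction l with
  | zero =>
    convert MeasurePreserving.id _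
    ext1 ω
    simp
  | succ n ih =>
    convert h1.comp ih using 1
    ext1 ω
    simp [shift_shift, add_comm]
  | pred n ih =>
    convert hneg.comp ih using 1
    ext1 ω
    simp [shift_shift, sub_eq_add_neg, add_comm]

lemma lintegral_shift (l : ℤ) {g : (ℤ → S) → ℝ≥0∞} (hg : Measurable g) :
    ∫⁻ ω, g (shift l ω) ∂stationaryLaw p m hm = ∫⁻ ω, g ω ∂stationaryLaw p m hm :=
  (measurePreserving_shift p m hm l).lintegral_comp hg

end Stationary

/-! ### Counting by positive partial sums -/

/-- If `P a` holds and all partial sums of `f` up to time `k` from an index with property `P` on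
are positive, then the sum from `a` on is at least the number of indices with property `P`. -/
lemma card_filter_Ico_le_sum (f : ℕ → ℤ) (P : ℕ → Prop) [DecidablePred P] (k : ℕ)
    (h : ∀ l n, P l → l < n → n ≤ k → 0 < ∑ r ∈ Finset.Ico l n, f r) (a : ℕ) (hak : a < k)
    (ha : P a) : (((Finset.Ico a k).filter P).card : ℤ) ≤ ∑ r ∈ Finset.Ico a k, f r := by
  induction hd : k - a using Nat.strong_induction_on generalizing a with
  | _ d ih =>
  have hsplit : (Finset.Ico a k).filter P = insert a ((Finset.Ico (a + 1) k).filter P) := by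
    rw [← Finset.insert_Ico_add_one_left_eq_Ico hak, Finset.filter_insert, if_pos ha]
  -- If `b` is the next index after `a` with property `P`, the block `[a, b)` has a positive integer
  -- sum, hence at least `1`, which pays for `a`; the induction covers `[b, k)`.
  by_cases hne : ∃ b, (a < b ∧ b < k) ∧ P b
  · have hb := Nat.find_spec hne
    have hmin : ∀ r, a < r → r < Nat.find hne → ¬ P r := fun r h1 h2 h3 =>
      Nat.find_min hne h2 ⟨⟨h1, h2.trans hb.1.2⟩, h3⟩
    set b := Nat.find hne
    have hset : (Finset.Ico (a + 1) k).filter P = (Finset.Ico b k).filter P := by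
      ext r
      simp only [Finset.mem_filter, Finset.mem_Ico]
      constructor
      · rintro ⟨⟨h1, h2⟩, h3⟩
        exact ⟨⟨not_lt.1 fun hr => hmin r h1 hr h3, h2⟩, h3⟩
      · rintro ⟨⟨h1, h2⟩, h3⟩
        exact ⟨⟨by omega, h2⟩, h3⟩
    have h1 := ih (k - b) (by omega) b hb.1.2 hb.2 rfl
    have h2 := h a b ha hb.1.1 hb.1.2.le
    rw [← Finset.sum_Ico_consecutive f hb.1.1.le hb.1.2.le, hsplit,
      Finset.card_insert_of_notMem (by simp), hset]
    push_cast
    linarith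
  · have hset : (Finset.Ico (a + 1) k).filter P = ∅ := by
      ext r
      simp only [Finset.mem_filter, Finset.mem_Ico, Finset.notMem_empty, iff_false]
      exact fun hr => hne ⟨r, ⟨hr.1.1, hr.1.2⟩, hr.2⟩
    have h2 := h a k ha hak le_rfl
    rw [hsplit, hset]
    simpa using Int.add_one_le_iff.2 h2

open scoped Classical in
/-- If all partial sums of `f` up to time `k` from an index with property `P` on are positive,
then the sum from the first such index on is at least the number of indices with property `P`. -/
lemma card_filter_range_le_sum (f : ℕ → ℤ) (P : ℕ → Prop) (k : ℕ)
    (h : ∀ l n, P l → l < n → n ≤ k → 0 < ∑ r ∈ Finset.Ico l n, f r) :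
    (((Finset.range k).filter P).card : ℤ) ≤
      ∑ n ∈ Finset.range k, if ∃ l ≤ n, P l then f n else 0 := by
  by_cases hne : ∃ a, a < k ∧ P a
  · have ha := Nat.find_spec hne
    have hmin : ∀ r, r < Nat.find hne → ¬ P r := fun r h2 h3 =>
      Nat.find_min hne h2 ⟨h2.trans ha.1, h3⟩
    set a := Nat.find hne
    have h1 := card_filter_Ico_le_sum f P k h a ha.1 ha.2
    rw [Finset.range_eq_Ico, ← Finset.sum_Ico_consecutive _ (Nat.zero_le a) ha.1.le]
    have h2 : (∑ n ∈ Finset.Ico 0 a, if ∃ l ≤ n, P l then f n else 0) = 0 := by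
      refine Finset.sum_eq_zero fun n hn => if_neg ?_
      rintro ⟨l, hl, hP⟩
      exact hmin l (by have := (Finset.mem_Ico.1 hn).2; omega) hP
    have h3 : (∑ n ∈ Finset.Ico a k, if ∃ l ≤ n, P l then f n else 0) =
        ∑ n ∈ Finset.Ico a k, f n :=
      Finset.sum_congr rfl fun n hn => if_pos ⟨a, (Finset.mem_Ico.1 hn).1, ha.2⟩
    have h4 : (Finset.Ico 0 k).filter P = (Finset.Ico a k).filter P := by
      ext r
      simp only [Finset.mem_filter, Finset.mem_Ico]
      constructor
      · rintro ⟨⟨-, h2⟩, h3⟩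
        exact ⟨⟨not_lt.1 fun hr => hmin r hr h3, h2⟩, h3⟩
      · rintro ⟨⟨h1, h2⟩, h3⟩
        exact ⟨⟨Nat.zero_le _, h2⟩, h3⟩
    rw [h2, h3, h4, zero_add]
    exact h1
  · have h1 : (Finset.range k).filter P = ∅ := by
      ext r
      simp only [Finset.mem_filter, Finset.mem_range, Finset.notMem_empty, iff_false]
      exact fun hr => hne ⟨r, hr⟩
    rw [h1, Finset.sum_eq_zero]
    · simp
    · intro n hn
      refine if_neg ?_
      rintro ⟨l, hl, hP⟩
      exact hne ⟨l, by have := Finset.mem_range.1 hn; omega, hP⟩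

/-! ### Concave functions and truncated expectations -/

/-- Summation by parts, done as an induction on the stronger lower bound `Δ N * ∑ r ∈ range N, w r`.
-/
lemma sum_mul_nonneg_of_antitone {Δ w : ℕ → ℝ} (hΔ : Antitone Δ) (hΔ0 : ∀ n, 0 ≤ Δ n)
    (hw : ∀ n, 0 ≤ ∑ r ∈ Finset.range n, w r) (N : ℕ) :
    0 ≤ ∑ r ∈ Finset.range N, Δ r * w r := by
  have key : ∀ N, Δ N * ∑ r ∈ Finset.range N, w r ≤ ∑ r ∈ Finset.range N, Δ r * w r := by
    intro N
    induction N with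
    | zero => simp
    | succ N ih =>
      calc Δ (N + 1) * ∑ r ∈ Finset.range (N + 1), w r
          ≤ Δ N * ∑ r ∈ Finset.range (N + 1), w r :=
            mul_le_mul_of_nonneg_right (hΔ N.le_succ) (hw _)
        _ ≤ _ := by
            rw [Finset.sum_range_succ, Finset.sum_range_succ, mul_add]
            linarith
  exact (mul_nonneg (hΔ0 N) (hw N)).trans (key N)

/-- The increments of a non-negative concave function are non-negative. -/
lemma IsConcave.increment_nonneg {ψ : ℕ → ℝ} (hψ : IsConcave ψ) (h0 : ∀ n, 0 ≤ ψ n) (n : ℕ) :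
    0 ≤ ψ (n + 1) - ψ n := by
  by_contra! hneg
  have hanti : Antitone fun n => ψ (n + 1) - ψ n := antitone_nat_of_succ_le hψ
  -- By concavity a negative increment persists, so `ψ` lies below a line of negative slope and
  -- eventually becomes negative.
  have hle : ∀ k : ℕ, ψ (n + k) ≤ ψ n + k * (ψ (n + 1) - ψ n) := by
    intro k
    induction k with
    | zero => simp
    | succ k ih =>
      have := hanti (Nat.le_add_right n k)
      simp only at this
      push_cast
      rw [← add_assoc]
      linarith
  obtain ⟨k, hk⟩ := exists_nat_gt (ψ n / -(ψ (n + 1) - ψ n))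
  rw [div_lt_iff₀ (by linarith)] at hk
  have h1 := hle k
  have h2 := h0 (n + k)
  nlinarith

/-- Layer-cake formula: telescope `ψ (U z)` over `r < U z` and exchange sum and integral, which is
free because the increments are non-negative. -/
lemma lintegral_ofReal_concave {Ω : Type*} [MeasurableSpace Ω] (μ : Measure Ω)
    [IsProbabilityMeasure μ] {U : Ω → ℕ} (hU : Measurable U) {ψ : ℕ → ℝ} (h0 : ∀ n, 0 ≤ ψ n)
    (hΔ : ∀ n, 0 ≤ ψ (n + 1) - ψ n) :
    ∫⁻ z, ENNReal.ofReal (ψ (U z)) ∂μ = ENNReal.ofReal (ψ 0) +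
      ∑' r, ENNReal.ofReal (ψ (r + 1) - ψ r) * μ {z | r < U z} := by
  have hpt : ∀ n : ℕ, ENNReal.ofReal (ψ n) = ENNReal.ofReal (ψ 0) +
      ∑' r, ENNReal.ofReal (ψ (r + 1) - ψ r) * (if r < n then 1 else 0) := by
    intro n
    rw [tsum_eq_sum (s := Finset.range n) fun r hr => by
      rw [if_neg (by simpa using hr), mul_zero]]
    rw [Finset.sum_congr rfl fun r hr => by rw [if_pos (Finset.mem_range.1 hr), mul_one],
      ← ENNReal.ofReal_sum_of_nonneg fun r _ => hΔ r, Finset.sum_range_sub,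
      ← ENNReal.ofReal_add (h0 0) (by
        rw [← Finset.sum_range_sub]; exact Finset.sum_nonneg fun r _ => hΔ r)]
    congr 1
    ring
  have hms : ∀ r, MeasurableSet {z | r < U z} := fun r =>
    hU (MeasurableSet.of_discrete (s := Set.Ioi r))
  have hind : ∀ (r : ℕ) z, (if r < U z then (1 : ℝ≥0∞) else 0) =
      Set.indicator {z | r < U z} 1 z := fun r z => by simp [Set.indicator_apply]
  simp_rw [fun z => hpt (U z), hind]
  rw [lintegral_add_left measurable_const, lintegral_const, measure_univ, mul_one, lintegral_tsum]
  · congr 1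
    refine tsum_congr fun r => ?_
    rw [lintegral_const_mul _ (measurable_one.indicator (hms r)), lintegral_indicator_one (hms r)]
  · intro r
    exact ((measurable_one.indicator (hms r)).const_mul _).aemeasurable

/-- Comparison of the expectations of a concave function, from the comparison of the truncated
expectations `E[min U k] = ∑_{r < k} P(r < U)`. -/
theorem lintegral_concave_le {Ω Ω' : Type*} [MeasurableSpace Ω] [MeasurableSpace Ω']
    (μ : Measure Ω) (μ' : Measure Ω') [IsProbabilityMeasure μ] [IsProbabilityMeasure μ']
    {U : Ω → ℕ} {V : Ω' → ℕ} (hU : Measurable U) (hV : Measurable V)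
    (h : ∀ k, ∑ r ∈ Finset.range k, μ {z | r < U z} ≤ ∑ r ∈ Finset.range k, μ' {z | r < V z})
    {ψ : ℕ → ℝ} (h0 : ∀ n, 0 ≤ ψ n) (hψ : IsConcave ψ) :
    ∫⁻ z, ENNReal.ofReal (ψ (U z)) ∂μ ≤ ∫⁻ z, ENNReal.ofReal (ψ (V z)) ∂μ' := by
  have hΔ := hψ.increment_nonneg h0
  rw [lintegral_ofReal_concave μ hU h0 hΔ, lintegral_ofReal_concave μ' hV h0 hΔ]
  -- It suffices to compare partial sums with the same cutoff `N`; these are finite, so the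
  -- difference of the two sides can be formed in `ℝ`.
  refine add_le_add_right (ENNReal.tsum_le_of_sum_range_le fun N => ?_) _
  refine le_trans ?_ (ENNReal.sum_le_tsum (Finset.range N))
  have hw : ∀ k, 0 ≤ ∑ r ∈ Finset.range k, (μ'.real {z | r < V z} - μ.real {z | r < U z}) := by
    intro k
    rw [Finset.sum_sub_distrib, sub_nonneg]
    have := ENNReal.toReal_mono (by simp) (h k)
    rwa [ENNReal.toReal_sum (by simp), ENNReal.toReal_sum (by simp)] at this
  have hsum := sum_mul_nonneg_of_antitone (Δ := fun n => ψ (n + 1) - ψ n)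
    (antitone_nat_of_succ_le hψ) hΔ hw N
  simp_rw [mul_sub _ (μ'.real _)] at hsum
  rw [Finset.sum_sub_distrib, sub_nonneg] at hsum
  have hconv : ∀ u : ℕ → ℝ≥0∞, (∀ r, u r ≠ ⊤) →
      ∑ r ∈ Finset.range N, ENNReal.ofReal (ψ (r + 1) - ψ r) * u r =
        ENNReal.ofReal (∑ r ∈ Finset.range N, (ψ (r + 1) - ψ r) * (u r).toReal) := by
    intro u hu
    rw [ENNReal.ofReal_sum_of_nonneg fun r _ => mul_nonneg (hΔ r) ENNReal.toReal_nonneg]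
    refine Finset.sum_congr rfl fun r _ => ?_
    rw [ENNReal.ofReal_mul (hΔ r), ENNReal.ofReal_toReal (hu r)]
  rw [hconv _ fun r => measure_ne_top _ _, hconv _ fun r => measure_ne_top _ _]
  refine ENNReal.ofReal_le_ofReal ?_
  exact hsum

/-! ### Charge and survival events -/

section Survival

variable {S : Type*}

open scoped Classical in
/-- A visit to `i` has charge `1`, a visit to `s` uses up the charge `κ s`. -/
noncomputable def charge (i : S) (κ : S → ℕ) (s : S) : ℤ := (if s = i then 1 else 0) - κ s

/-- The trajectories for which the accumulated charge of the time interval `[0, n]` is positive for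
all `n ≤ r`. -/
def survival (f : S → ℤ) (r : ℕ) : Set (ℤ → S) :=
  {ω | ∀ n ≤ r, 0 < ∑ s ∈ Finset.range (n + 1), f (ω s)}

lemma apply_zero_eq_of_charge_pos {i : S} {κ : S → ℕ} {s : S} (h : 0 < charge i κ s) : s = i := by
  by_contra hs
  simp only [charge, hs, if_false] at h
  omega

lemma survival_subset (i : S) (κ : S → ℕ) (r : ℕ) :
    survival (charge i κ) r ⊆ {ω | ω 0 = i} := fun ω hω =>
  apply_zero_eq_of_charge_pos (κ := κ) (by simpa using hω 0 (Nat.zero_le _))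

lemma measurable_sum_coord [MeasurableSpace S] [DiscreteMeasurableSpace S] (f : S → ℤ) (n : ℕ) :
    Measurable fun ω : ℤ → S => ∑ s ∈ Finset.range n, f (ω s) :=
  Finset.measurable_sum _ fun s _ =>
    (Measurable.of_discrete (f := f)).comp (measurable_pi_apply (s : ℤ))

lemma measurableSet_survival [MeasurableSpace S] [DiscreteMeasurableSpace S] (f : S → ℤ) (r : ℕ) :
    MeasurableSet (survival f r) := by
  have : survival f r =
      ⋂ n : Fin (r + 1), (fun ω : ℤ → S => ∑ s ∈ Finset.range (n + 1), f (ω s)) ⁻¹' Set.Ioi 0 := by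
    ext ω
    simp [survival, Fin.forall_iff]
  rw [this]
  exact MeasurableSet.iInter fun n => measurable_sum_coord f _ .of_discrete

lemma sum_range_shift (f : S → ℤ) (ω : ℤ → S) (l n : ℕ) :
    ∑ s ∈ Finset.range n, f (shift l ω s) = ∑ r ∈ Finset.Ico l (l + n), f (ω r) := by
  rw [Finset.sum_Ico_eq_sum_range]
  simp [add_comm]

lemma measurable_shift_random [MeasurableSpace S] {Ω : Type*} [MeasurableSpace Ω]
    {T : (ℤ → S) × Ω → ℤ} (hT : Measurable T) : Measurable fun (z : (ℤ → S) × Ω) (n : ℤ) => z.1 (n + T z) := by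
  refine measurable_pi_iff.2 fun n => ?_
  have h : Measurable fun q : ℤ × (ℤ → S) => q.2 (n + q.1) :=
    measurable_from_prod_countable_right fun t => measurable_pi_apply (n + t)
  exact h.comp (hT.prodMk measurable_fst)

end Survival

/-! ### Charge balance and mass transport in a finite window -/

section Window

variable {S : Type*} [MeasurableSpace S] [DiscreteMeasurableSpace S]

open scoped Classical in
/-- If on `B l` the accumulated charge of `[l, n)` is positive for all `n ≤ k`, then the measures of
the `B l` are controlled by the charge accumulated since the first `l` for which `B l` occurs. -/
lemma sum_measure_add_lintegral_le (μ : Measure (ℤ → S)) (i : S) (κ : S → ℕ)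
    (B : ℕ → Set (ℤ → S)) (hB : ∀ l, MeasurableSet (B l)) (k : ℕ)
    (h : ∀ ω l n, ω ∈ B l → l < n → n ≤ k → 0 < ∑ r ∈ Finset.Ico l n, charge i κ (ω r)) :
    ∑ l ∈ Finset.range k, μ (B l) +
        ∑ n ∈ Finset.range k, ∫⁻ ω in ⋃ l ≤ n, B l, (κ (ω n) : ℝ≥0∞) ∂μ ≤
      ∑ n ∈ Finset.range k, μ ((⋃ l ≤ n, B l) ∩ {ω | ω n = i}) := by
  have hE : ∀ n : ℕ, MeasurableSet (⋃ l ≤ n, B l) := fun n =>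
    MeasurableSet.iUnion fun l => MeasurableSet.iUnion fun _ => hB l
  have hκ : ∀ n : ℕ, Measurable fun ω : ℤ → S => (κ (ω n) : ℝ≥0∞) := fun n =>
    (Measurable.of_discrete (f := fun s => (κ s : ℝ≥0∞))).comp (measurable_pi_apply (n : ℤ))
  have hX : ∀ n : ℕ, MeasurableSet ((⋃ l ≤ n, B l) ∩ {ω | ω n = i}) := fun n =>
    (hE n).inter (measurableSet_coord_eq _ _)
  have e1 : ∑ l ∈ Finset.range k, μ (B l) =
      ∫⁻ ω, ∑ l ∈ Finset.range k, (B l).indicator 1 ω ∂μ := by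
    rw [lintegral_finsetSum _ fun l _ => measurable_one.indicator (hB l)]
    simp_rw [lintegral_indicator_one (hB _)]
  have e2 : ∑ n ∈ Finset.range k, ∫⁻ ω in ⋃ l ≤ n, B l, (κ (ω n) : ℝ≥0∞) ∂μ =
      ∫⁻ ω, ∑ n ∈ Finset.range k, (⋃ l ≤ n, B l).indicator (fun ω => (κ (ω n) : ℝ≥0∞)) ω ∂μ := by
    rw [lintegral_finsetSum _ fun n _ => (hκ n).indicator (hE n)]
    simp_rw [lintegral_indicator (hE _)]
  have e3 : ∑ n ∈ Finset.range k, μ ((⋃ l ≤ n, B l) ∩ {ω | ω n = i}) =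
      ∫⁻ ω, ∑ n ∈ Finset.range k, ((⋃ l ≤ n, B l) ∩ {ω | ω n = i}).indicator 1 ω ∂μ := by
    rw [lintegral_finsetSum _ fun n _ => measurable_one.indicator (hX n)]
    simp_rw [lintegral_indicator_one (hX _)]
  rw [e1, e2, e3, ← lintegral_add_left
    (Finset.measurable_sum _ fun l _ => measurable_one.indicator (hB l))]
  refine lintegral_mono fun ω => ?_
  have key := card_filter_range_le_sum (fun n => charge i κ (ω n)) (fun l => ω ∈ B l) k (h ω)
  -- The capacities are moved to the left so that the pointwise inequality holds in `ℕ` and can be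
  -- integrated in `ℝ≥0∞` without subtraction.
  have key2 : ((Finset.range k).filter fun l => ω ∈ B l).card +
      ∑ n ∈ Finset.range k, (if ∃ l ≤ n, ω ∈ B l then κ (ω n) else 0) ≤
      ∑ n ∈ Finset.range k, (if (∃ l ≤ n, ω ∈ B l) ∧ ω n = i then 1 else 0) := by
    rw [← Nat.cast_le (α := ℤ)]
    have : ∀ n : ℕ, (if ∃ l ≤ n, ω ∈ B l then charge i κ (ω n) else 0) =
        (if (∃ l ≤ n, ω ∈ B l) ∧ ω n = i then (1 : ℤ) else 0) -
          (if ∃ l ≤ n, ω ∈ B l then (κ (ω n) : ℤ) else 0) := by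
      intro n
      by_cases h1 : ∃ l ≤ n, ω ∈ B l
      · simp only [h1, if_true, true_and, charge]
      · simp only [h1, if_false, false_and, sub_zero]
    simp_rw [this] at key
    rw [Finset.sum_sub_distrib] at key
    push_cast
    linarith
  have key3 : ((((Finset.range k).filter fun l => ω ∈ B l).card +
      ∑ n ∈ Finset.range k, (if ∃ l ≤ n, ω ∈ B l then κ (ω n) else 0) : ℕ) : ℝ≥0∞) ≤
      ((∑ n ∈ Finset.range k, (if (∃ l ≤ n, ω ∈ B l) ∧ ω n = i then 1 else 0) : ℕ) : ℝ≥0∞) := by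
    exact_mod_cast key2
  rw [Finset.card_filter] at key3
  push_cast at key3
  simpa [Set.indicator_apply] using key3

variable [Countable S] (p : S → PMF S) (m : S → ℝ≥0) (hm : IsStationary p m) (i : S)

lemma stationaryLaw_inter_coord (l : ℤ) {s : Set (ℤ → S)} (hs : MeasurableSet s) :
    stationaryLaw p m hm (s ∩ {ω | ω l = i}) =
      m i * twoSidedLaw p m hm i (shift (-l) ⁻¹' s) := by
  rw [← stationaryLaw_inter p m hm i (measurable_shift _ hs),
    ← (measurePreserving_shift p m hm (-l)).measure_preimage
      (hs.inter (measurableSet_coord_eq _ _)).nullMeasurableSet]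
  congr 1
  ext ω
  simp

lemma lintegral_stationaryLaw_coord (n : ℤ) (κ : S → ℕ) {s : Set (ℤ → S)} (hs : MeasurableSet s) :
    ∫⁻ ω in s, (κ (ω n) : ℝ≥0∞) ∂stationaryLaw p m hm =
      ∑' j, m j * κ j * twoSidedLaw p m hm j (shift (-n) ⁻¹' s) := by
  have hκ : ∀ n : ℤ, Measurable fun ω : ℤ → S => (κ (ω n) : ℝ≥0∞) := fun n =>
    (Measurable.of_discrete (f := fun s => (κ s : ℝ≥0∞))).comp (measurable_pi_apply n)
  have hs' : MeasurableSet (shift (-n) ⁻¹' s) := measurable_shift _ hs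
  rw [← lintegral_indicator hs, ← lintegral_shift p m hm (-n) ((hκ n).indicator hs),
    lintegral_stationaryLaw]
  refine tsum_congr fun j => ?_
  rw [mul_assoc, ← lintegral_indicator_one hs', ← lintegral_const_mul _
    (measurable_one.indicator hs')]
  congr 1
  refine lintegral_congr_ae ?_
  filter_upwards [ae_twoSidedLaw_zero p m hm j] with ω hω
  by_cases h : shift (-n) ω ∈ s
  · rw [Set.indicator_of_mem h, Set.indicator_of_mem (show ω ∈ shift (-n) ⁻¹' s from h)]
    simp [hω]
  · rw [Set.indicator_of_notMem h, Set.indicator_of_notMem (show ω ∉ shift (-n) ⁻¹' s from h)]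
    simp

/-- This is where the choice of `κ` matters: seen from time `n`, the law `P_ν` scaled by `m i` has
density `κ (ω n)` with respect to the invariant measure. -/
lemma mul_twoSidedLawOf (ν : PMF S) (κ : S → ℕ)
    (hκ : ∀ j, (m i : ℝ≥0∞) * ν j = m j * κ j) (n : ℤ) {s : Set (ℤ → S)} (hs : MeasurableSet s) :
    m i * twoSidedLawOf p m hm ν (shift (-n) ⁻¹' s) =
      ∫⁻ ω in s, (κ (ω n) : ℝ≥0∞) ∂stationaryLaw p m hm := by
  rw [lintegral_stationaryLaw_coord p m hm n κ hs, twoSidedLawOf,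
    Measure.sum_apply _ (measurable_shift _ hs), ← ENNReal.tsum_mul_left]
  refine tsum_congr fun j => ?_
  rw [Measure.smul_apply, smul_eq_mul, ← mul_assoc, hκ]

instance (ν : PMF S) : IsProbabilityMeasure (twoSidedLawOf p m hm ν) := by
  constructor
  simp [twoSidedLawOf, PMF.tsum_coe]

instance {Ω : Type*} [MeasurableSpace Ω] (Q : Kernel (ℤ → S) Ω) [IsMarkovKernel Q] :
    IsProbabilityMeasure (extendedLaw p m hm i Q) := by
  unfold extendedLaw
  infer_instance

/-- The integral is `m i` times a probability. Its finiteness allows the capacity terms to be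
cancelled in `ℝ≥0∞`. -/
lemma lintegral_charge_ne_top (ν : PMF S) (κ : S → ℕ)
    (hκ : ∀ j, (m i : ℝ≥0∞) * ν j = m j * κ j) (n : ℤ) {s : Set (ℤ → S)} (hs : MeasurableSet s) :
    ∫⁻ ω in s, (κ (ω n) : ℝ≥0∞) ∂stationaryLaw p m hm ≠ ⊤ := by
  rw [← mul_twoSidedLawOf p m hm i ν κ hκ n hs]
  exact ENNReal.mul_ne_top ENNReal.coe_ne_top (measure_ne_top _ _)

/-- Mass transport: the visits to `i` in a window that are not transported out of the window by `T`
land on states whose capacity `κ` bounds the received mass. -/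
lemma sum_measure_inter_le (ν : PMF S) (κ : S → ℕ)
    (hκ : ∀ j, (m i : ℝ≥0∞) * ν j = m j * κ j)
    {Ω : Type*} [MeasurableSpace Ω] (Q : Kernel (ℤ → S) Ω)
    [IsMarkovKernel Q] (T : (ℤ → S) × Ω → ℕ)
    (hT : IsEmbedding p m hm i ν Q (fun z => (T z : ℤ))) (E : ℕ → Set (ℤ → S))
    (hE : ∀ n, MeasurableSet (E n)) (hmono : Monotone E) (k : ℕ) :
    ∑ n ∈ Finset.range k, stationaryLaw p m hm (E n ∩ {ω | ω n = i}) ≤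
      m i * ∑ r ∈ Finset.range k, extendedLaw p m hm i Q {z | r < T z} +
        ∑ n ∈ Finset.range k, ∫⁻ ω in E n, (κ (ω n) : ℝ≥0∞) ∂stationaryLaw p m hm := by
  set P := extendedLaw p m hm i Q
  have hTm : Measurable fun z => (T z : ℤ) := hT.measurable
  -- Transport from `l` to `n` while `E n` holds. Under `P` the visit to `i` sits at time `0`, so
  -- `shift (-l)` places it at `l`.
  set G : ℕ → ℕ → Set ((ℤ → S) × Ω) := fun l n => {z | l + T z = n ∧ shift (-l) z.1 ∈ E n}
  have hGm : ∀ l n, MeasurableSet (G l n) := by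
    intro l n
    have h1 : MeasurableSet {z | l + T z = n} := by
      have : {z | l + T z = n} = (fun z => (T z : ℤ)) ⁻¹' {(n : ℤ) - l} := by
        ext z
        simp only [Set.mem_ofPred_eq, Set.mem_preimage, Set.mem_singleton_iff]
        omega
      rw [this]
      exact hTm .of_discrete
    exact h1.inter (((measurable_shift (-(l : ℤ))).comp measurable_fst) (hE n))
  -- A visit at `l` leaves the window exactly when `T` exceeds `k - 1 - l`. Otherwise it lands at `n
  -- = l + T`, where `E n` holds by monotonicity.
  have hleft : ∀ l ∈ Finset.range k, stationaryLaw p m hm (E l ∩ {ω | ω l = i}) ≤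
      m i * P {z | k - 1 - l < T z} + ∑ n ∈ Finset.Ico l k, m i * P (G l n) := by
    intro l hl
    rw [Finset.mem_range] at hl
    rw [stationaryLaw_inter_coord p m hm i l (hE l), ← Finset.mul_sum, ← mul_add]
    gcongr
    have hfst : P.map Prod.fst = twoSidedLaw p m hm i := Measure.fst_compProd _ _
    rw [← hfst, Measure.map_apply measurable_fst (measurable_shift _ (hE l))]
    refine le_trans (measure_mono (t := {z | k - 1 - l < T z} ∪ ⋃ n ∈ Finset.Ico l k, G l n) ?_)
      ((measure_union_le _ _).trans (add_le_add_right (measure_biUnion_finset_le _ _) _))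
    intro z hz
    by_cases h : k - 1 - l < T z
    · exact Or.inl h
    · refine Or.inr (Set.mem_iUnion₂.2 ⟨l + T z, Finset.mem_Ico.2 (by omega), rfl, ?_⟩)
      exact hmono (Nat.le_add_right _ _) hz
  -- For fixed `n` the value of `T` determines `l`, so the sources are disjoint. Together they lie
  -- in the event that the trajectory seen from `T`, with its origin placed at `n`, is in `E n`, and
  -- the embedding property gives the probability of that event under `P_ν`.
  have hright : ∀ n ∈ Finset.range k, ∑ l ∈ Finset.Ico 0 (n + 1), m i * P (G l n) ≤
      ∫⁻ ω in E n, (κ (ω n) : ℝ≥0∞) ∂stationaryLaw p m hm := by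
    intro n _
    rw [← Finset.mul_sum, ← mul_twoSidedLawOf p m hm i ν κ hκ n (hE n), ← hT.law,
      Measure.map_apply (measurable_shift_random hTm) (measurable_shift _ (hE n)),
      ← measure_biUnion_finset _ fun l _ => hGm l n]
    · gcongr
      intro z hz
      obtain ⟨l, -, hl, hz⟩ := Set.mem_iUnion₂.1 hz
      change shift (-n) (shift (T z) z.1) ∈ E n
      rw [shift_shift]
      convert hz using 2
      omega
    · intro a _ b _ hab
      refine Set.disjoint_left.2 fun z hza hzb => hab ?_
      have := hza.1
      have := hzb.1
      omega
  calc _ ≤ ∑ l ∈ Finset.range k, (m i * P {z | k - 1 - l < T z} +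
        ∑ n ∈ Finset.Ico l k, m i * P (G l n)) := Finset.sum_le_sum hleft
    _ = m i * ∑ r ∈ Finset.range k, P {z | r < T z} +
        ∑ n ∈ Finset.range k, ∑ l ∈ Finset.Ico 0 (n + 1), m i * P (G l n) := by
      rw [Finset.sum_add_distrib, ← Finset.mul_sum,
        Finset.sum_range_reflect (fun r => P {z | r < T z}), Finset.range_eq_Ico,
        Finset.sum_Ico_Ico_comm]
    _ ≤ _ := add_le_add_right (Finset.sum_le_sum hright) _

/-- The truncated expectation of the first time at which the accumulated charge is not positive is
minimal among all solutions of the embedding problem. -/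
theorem sum_survival_le (ν : PMF S) (κ : S → ℕ)
    (hκ : ∀ j, (m i : ℝ≥0∞) * ν j = m j * κ j)
    {Ω : Type*} [MeasurableSpace Ω] (Q : Kernel (ℤ → S) Ω)
    [IsMarkovKernel Q] (T : (ℤ → S) × Ω → ℕ)
    (hT : IsEmbedding p m hm i ν Q (fun z => (T z : ℤ))) (k : ℕ) :
    ∑ r ∈ Finset.range k, twoSidedLaw p m hm i (survival (charge i κ) r) ≤
      ∑ r ∈ Finset.range k, extendedLaw p m hm i Q {z | r < T z} := by
  -- The times `l` in the window whose charge is still positive at its last time `k - 1`. The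
  -- condition `l < k` excludes the truncated values of `k - 1 - l`.
  set B : ℕ → Set (ℤ → S) := fun l =>
    {ω | l < k ∧ shift l ω ∈ survival (charge i κ) (k - 1 - l)}
  have hB : ∀ l, MeasurableSet (B l) := fun l =>
    (MeasurableSet.const _).inter (measurable_shift (l : ℤ) (measurableSet_survival _ _))
  have hpos : ∀ ω l n, ω ∈ B l → l < n → n ≤ k →
      0 < ∑ r ∈ Finset.Ico l n, charge i κ (ω r) := by
    intro ω l n hω hln hnk
    have := hω.2 (n - l - 1) (by omega)
    rw [sum_range_shift] at this
    rwa [show l + (n - l - 1 + 1) = n by omega] at this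
  have hE : ∀ n : ℕ, MeasurableSet (⋃ l ≤ n, B l) := fun n =>
    MeasurableSet.iUnion fun l => MeasurableSet.iUnion fun _ => hB l
  have hmono : Monotone fun n : ℕ => ⋃ l ≤ n, B l := fun a b hab =>
    Set.biUnion_subset_biUnion_left fun l hl => le_trans hl hab
  have h1 := sum_measure_add_lintegral_le (stationaryLaw p m hm) i κ B hB k hpos
  have h2 := sum_measure_inter_le p m hm i ν κ hκ Q T hT _ hE hmono k
  have h3 := ENNReal.le_of_add_le_add_right (ENNReal.sum_ne_top.2 fun n _ =>
    lintegral_charge_ne_top p m hm i ν κ hκ (n : ℕ) (hE n)) (h1.trans h2)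
  -- By invariance `B l` has the measure of survival up to `k - 1 - l`; reversing the order of
  -- summation gives all `r < k`.
  have h4 : ∑ l ∈ Finset.range k, stationaryLaw p m hm (B l) =
      m i * ∑ r ∈ Finset.range k, twoSidedLaw p m hm i (survival (charge i κ) r) := by
    rw [← Finset.sum_range_reflect, Finset.mul_sum]
    refine Finset.sum_congr rfl fun l hl => ?_
    rw [← stationaryLaw_inter p m hm i (measurableSet_survival _ _),
      Set.inter_eq_left.2 (survival_subset i κ _),
      ← (measurePreserving_shift p m hm (k - 1 - l : ℕ)).measure_preimage
        (measurableSet_survival _ _).nullMeasurableSet]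
    congr 1
    ext ω
    rw [Finset.mem_range] at hl
    simp only [B, Set.mem_ofPred_eq, Set.mem_preimage, show k - 1 - (k - 1 - l) = l by omega]
    exact and_iff_right (by omega)
  rw [h4] at h3
  exact (ENNReal.mul_le_mul_iff_right (by exact_mod_cast (hm.pos i).ne') ENNReal.coe_ne_top).1 h3

end Window

/-! ### Recurrence of events and finiteness of the stopping time -/

section Recurrence

variable {S : Type*} [MeasurableSpace S] [DiscreteMeasurableSpace S] [Countable S]
  (p : S → PMF S) (m : S → ℝ≥0) (hm : IsStationary p m) (i : S)

/-- A set that every trajectory visits at most once is a null set. -/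
lemma stationaryLaw_eq_zero_of_wandering (hrec : IsRecurrent p) {B : Set (ℤ → S)}
    (hB : MeasurableSet B) (hBi : B ⊆ {ω | ω 0 = i})
    (hw : ∀ ω (a b : ℤ), shift a ω ∈ B → shift b ω ∈ B → a = b) :
    stationaryLaw p m hm B = 0 := by
  set μ := stationaryLaw p m hm with hμ
  -- Moving the origin to time `n` turns the visits to `i` at time `n` into disjoint subsets of
  -- `{X_0 = i}`, of total measure at most `m i`. By Borel–Cantelli almost every trajectory in `B`
  -- visits `i` finitely often in the future, which recurrence excludes.
  have hshift : ∀ n : ℕ, μ (B ∩ {ω | ω n = i}) = μ (shift (-n) ⁻¹' B ∩ {ω | ω 0 = i}) := by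
    intro n
    rw [hμ, stationaryLaw_inter_coord p m hm i n hB,
      stationaryLaw_inter p m hm i (measurable_shift _ hB)]
  have hsum : ∑' n : ℕ, μ (B ∩ {ω | ω n = i}) ≠ ⊤ := by
    simp_rw [hshift]
    rw [← measure_iUnion]
    · refine ne_top_of_le_ne_top ?_ (measure_mono
        (Set.iUnion_subset fun n => Set.inter_subset_right (t := {ω : ℤ → S | ω 0 = i})))
      rw [← Set.univ_inter {ω : ℤ → S | ω 0 = i}, stationaryLaw_inter p m hm i .univ]
      exact ENNReal.mul_ne_top ENNReal.coe_ne_top (measure_ne_top _ _)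
    · intro a b hab
      refine Set.disjoint_left.2 fun ω ha hb => hab ?_
      have := hw ω _ _ ha.1 hb.1
      omega
    · exact fun n => (measurable_shift _ hB).inter (measurableSet_coord_eq _ _)
  have hfin := ae_twoSidedLaw_of_ae_stationaryLaw p m hm (ae_eventually_notMem hsum) i
  have hinf := ae_twoSidedLaw_forward p m hm i (hrec.ae_frequently i)
  have h0 : twoSidedLaw p m hm i B = 0 := by
    refine measure_eq_zero_iff_ae_notMem.2 ?_
    filter_upwards [hfin, hinf] with ω h1 h2 hω
    obtain ⟨N, hN⟩ := Filter.eventually_atTop.1 h1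
    obtain ⟨n, hn, hn'⟩ := h2 N
    exact hN n hn ⟨hω, hn'⟩
  rw [← Set.inter_eq_left.2 hBi, hμ, stationaryLaw_inter p m hm i hB, h0, mul_zero]

lemma ae_forall_shift {P : (ℤ → S) → Prop} (h : ∀ᵐ ω ∂stationaryLaw p m hm, P ω) :
    ∀ᵐ ω ∂stationaryLaw p m hm, ∀ l : ℤ, P (shift l ω) :=
  ae_all_iff.2 fun l => (measurePreserving_shift p m hm l).quasiMeasurePreserving.ae h

/-- Recurrence into the future: almost every trajectory that is in `A` at some time is in `A` at
some later time. -/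
lemma ae_exists_later (hrec : IsRecurrent p) {A : Set (ℤ → S)} (hA : MeasurableSet A)
    (hAi : A ⊆ {ω | ω 0 = i}) :
    ∀ᵐ ω ∂stationaryLaw p m hm, ∀ a : ℤ, shift a ω ∈ A → ∃ b, a < b ∧ shift b ω ∈ A := by
  -- `B` marks the last occurrence of `A`, so each trajectory has at most one such time.
  set B : Set (ℤ → S) := A ∩ ⋂ n : ℕ, (shift ((n : ℤ) + 1) ⁻¹' A)ᶜ
  have hB : MeasurableSet B :=
    hA.inter (MeasurableSet.iInter fun n => (measurable_shift _ hA).compl)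
  have hlt : ∀ ω (a b : ℤ), shift a ω ∈ B → shift b ω ∈ B → ¬ a < b := by
    intro ω a b ha hb hab
    refine Set.mem_iInter.1 ha.2 (b - a - 1).toNat ?_
    have := hb.1
    rw [Set.mem_preimage, shift_shift]
    convert this using 2
    omega
  have h0 := stationaryLaw_eq_zero_of_wandering p m hm i hrec hB
    (Set.inter_subset_left.trans hAi) fun ω a b ha hb =>
      le_antisymm (not_lt.1 (hlt ω b a hb ha)) (not_lt.1 (hlt ω a b ha hb))
  filter_upwards [ae_forall_shift p m hm (measure_eq_zero_iff_ae_notMem.1 h0)] with ω hω a ha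
  by_contra! hcon
  refine hω a ⟨ha, Set.mem_iInter.2 fun n hn => ?_⟩
  rw [Set.mem_preimage, shift_shift] at hn
  exact hcon _ (by omega) hn

/-- Recurrence into the past: almost every trajectory that is in `A` at some time is in `A` at
some earlier time. -/
lemma ae_exists_earlier (hrec : IsRecurrent p) {A : Set (ℤ → S)} (hA : MeasurableSet A)
    (hAi : A ⊆ {ω | ω 0 = i}) :
    ∀ᵐ ω ∂stationaryLaw p m hm, ∀ a : ℤ, shift a ω ∈ A → ∃ b, b < a ∧ shift b ω ∈ A := by
  set B : Set (ℤ → S) := A ∩ ⋂ n : ℕ, (shift (-((n : ℤ) + 1)) ⁻¹' A)ᶜ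
  have hB : MeasurableSet B :=
    hA.inter (MeasurableSet.iInter fun n => (measurable_shift _ hA).compl)
  have hlt : ∀ ω (a b : ℤ), shift a ω ∈ B → shift b ω ∈ B → ¬ b < a := by
    intro ω a b ha hb hab
    refine Set.mem_iInter.1 ha.2 (a - b - 1).toNat ?_
    have := hb.1
    rw [Set.mem_preimage, shift_shift]
    convert this using 2
    omega
  have h0 := stationaryLaw_eq_zero_of_wandering p m hm i hrec hB
    (Set.inter_subset_left.trans hAi) fun ω a b ha hb =>
      le_antisymm (not_lt.1 (hlt ω a b ha hb)) (not_lt.1 (hlt ω b a hb ha))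
  filter_upwards [ae_forall_shift p m hm (measure_eq_zero_iff_ae_notMem.1 h0)] with ω hω a ha
  by_contra! hcon
  refine hω a ⟨ha, Set.mem_iInter.2 fun n hn => ?_⟩
  rw [Set.mem_preimage, shift_shift] at hn
  exact hcon _ (by omega) hn

/-- For almost every trajectory, `A` occurs at some time in the past if and only if it occurs
infinitely often in the future. -/
lemma ae_past_iff_future (hrec : IsRecurrent p) {A : Set (ℤ → S)} (hA : MeasurableSet A)
    (hAi : A ⊆ {ω | ω 0 = i}) :
    ∀ᵐ ω ∂stationaryLaw p m hm, (∃ l : ℕ, shift (-(l : ℤ)) ω ∈ A) ↔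
      ∀ N : ℕ, ∃ n : ℕ, N ≤ n ∧ shift n ω ∈ A := by
  filter_upwards [ae_exists_later p m hm i hrec hA hAi, ae_exists_earlier p m hm i hrec hA hAi]
    with ω h1 h2
  constructor
  · rintro ⟨l, hl⟩ N
    have key : ∀ N : ℕ, ∃ b : ℤ, -(l : ℤ) + N ≤ b ∧ shift b ω ∈ A := by
      intro N
      induction N with
      | zero => exact ⟨_, by simp, hl⟩
      | succ N ih =>
        obtain ⟨b, hb, hbA⟩ := ih
        obtain ⟨c, hc, hcA⟩ := h1 b hbA
        exact ⟨c, by push_cast; omega, hcA⟩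
    obtain ⟨b, hb, hbA⟩ := key (l + N)
    lift b to ℕ using by omega
    exact ⟨b, by omega, hbA⟩
  · intro h
    obtain ⟨n, -, hn⟩ := h 0
    have key : ∀ N : ℕ, ∃ b : ℤ, b ≤ n - N ∧ shift b ω ∈ A := by
      intro N
      induction N with
      | zero => exact ⟨_, by simp, hn⟩
      | succ N ih =>
        obtain ⟨b, hb, hbA⟩ := ih
        obtain ⟨c, hc, hcA⟩ := h2 b hbA
        exact ⟨c, by push_cast; omega, hcA⟩
    obtain ⟨b, hb, hbA⟩ := key n
    exact ⟨(-b).toNat, by convert hbA using 2; omega⟩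

/-- Let `A ⊆ {x | x 0 = i}` be an event of one-sided trajectories. The probability that the forward
trajectory from some time `-l ≤ 0` on is in `A` does not depend on the starting point. -/
lemma twoSidedLaw_past_eq (hirr : IsIrreducible p) (hrec : IsRecurrent p) {A : Set (ℕ → S)}
    (hA : MeasurableSet A) (hAi : A ⊆ {x | x 0 = i}) (j : S) :
    twoSidedLaw p m hm j (⋃ l : ℕ, shift (-(l : ℤ)) ⁻¹' (forward ⁻¹' A)) =
      twoSidedLaw p m hm i (⋃ l : ℕ, shift (-(l : ℤ)) ⁻¹' (forward ⁻¹' A)) := by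
  -- Infinitely many future occurrences of `A`: a shift-invariant event that depends on the forward
  -- path only, unlike the event about the past that it replaces.
  set C : Set (ℕ → S) := {x | ∀ N : ℕ, ∃ n : ℕ, N ≤ n ∧ (fun r => x (n + r)) ∈ A} with hCdef
  have hC : MeasurableSet C := by
    have : C = ⋂ N : ℕ, ⋃ n : ℕ, ⋃ _ : N ≤ n, (fun x r => x (n + r)) ⁻¹' A := by
      ext x
      simp [C]
    rw [this]
    refine MeasurableSet.iInter fun N => MeasurableSet.iUnion fun n => MeasurableSet.iUnion fun _ =>
      (by fun_prop : Measurable fun (x : ℕ → S) r => x (n + r)) hA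
  have hinv : ∀ (n : ℕ) (x : ℕ → S), (fun r => x (n + r)) ∈ C ↔ x ∈ C := by
    intro n x
    constructor
    · intro h N
      obtain ⟨r, hr, hrA⟩ := h N
      refine ⟨n + r, by omega, ?_⟩
      simpa only [add_assoc] using hrA
    · intro h N
      obtain ⟨r, hr, hrA⟩ := h (n + N)
      refine ⟨r - n, by omega, ?_⟩
      simp only [← add_assoc]
      rwa [show n + (r - n) = r by omega]
  have key : ∀ j, twoSidedLaw p m hm j (⋃ l : ℕ, shift (-(l : ℤ)) ⁻¹' (forward ⁻¹' A)) =
      chainLaw p j C := by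
    intro j
    rw [← map_forward_twoSidedLaw p m hm j, Measure.map_apply measurable_forward hC]
    refine measure_congr ?_
    filter_upwards [ae_twoSidedLaw_of_ae_stationaryLaw p m hm
      (ae_past_iff_future p m hm i hrec (measurable_forward hA) fun ω hω => hAi hω) j] with ω hω
    refine propext ?_
    have hfs : ∀ n : ℕ, forward (shift n ω) = fun r => forward ω (n + r) := by
      intro n
      ext r
      simp [forward, add_comm]
    have e1 : ω ∈ (⋃ l : ℕ, shift (-(l : ℤ)) ⁻¹' (forward ⁻¹' A)) ↔
        ∃ l : ℕ, shift (-(l : ℤ)) ω ∈ forward ⁻¹' A := by simp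
    have e2 : ω ∈ forward ⁻¹' C ↔
        ∀ N : ℕ, ∃ n : ℕ, N ≤ n ∧ shift n ω ∈ forward ⁻¹' A := by
      simp only [Set.mem_preimage, hfs, hCdef]
      rfl
    exact (e1.trans hω).trans e2.symm
  rw [key, key, chainLaw_eq_of_invariant hrec hirr hC hinv i j]

/-- Almost surely, the accumulated charge does not stay positive forever. -/
theorem twoSidedLaw_iInter_survival (hirr : IsIrreducible p) (hrec : IsRecurrent p) (ν : PMF S)
    (κ : S → ℕ) (hκ : ∀ j, (m i : ℝ≥0∞) * ν j = m j * κ j) :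
    twoSidedLaw p m hm i (⋂ r, survival (charge i κ) r) = 0 := by
  set A : Set (ℕ → S) := {x | ∀ n, 0 < ∑ s ∈ Finset.range (n + 1), charge i κ (x s)}
  have hA : MeasurableSet A := by
    have : A = ⋂ n : ℕ, (fun x : ℕ → S => ∑ s ∈ Finset.range (n + 1), charge i κ (x s)) ⁻¹'
        Set.Ioi 0 := by
      ext x
      simp [A]
    rw [this]
    exact MeasurableSet.iInter fun n => (Finset.measurable_sum _ fun s _ =>
      (Measurable.of_discrete (f := charge i κ)).comp (measurable_pi_apply s)) .of_discrete
  have hAi : A ⊆ {x | x 0 = i} := fun x hx =>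
    apply_zero_eq_of_charge_pos (κ := κ) (by simpa using hx 0)
  have hAf : ⋂ r, survival (charge i κ) r = forward ⁻¹' A := by
    ext ω
    rw [Set.mem_iInter]
    exact ⟨fun h n => h n n le_rfl, fun h r n _ => h n⟩
  have hAm : MeasurableSet (forward ⁻¹' A : Set (ℤ → S)) := measurable_forward hA
  rw [hAf]
  set B : ℕ → Set (ℤ → S) := fun l => shift l ⁻¹' (forward ⁻¹' A)
  have hB : ∀ l, MeasurableSet (B l) := fun l => measurable_shift _ hAm
  have hE : ∀ n : ℕ, MeasurableSet (⋃ l ≤ n, B l) := fun n =>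
    MeasurableSet.iUnion fun l => MeasurableSet.iUnion fun _ => hB l
  -- Seen from time `n`, an occurrence of `A` in `[0, n]` becomes an occurrence in `[-n, 0]`. These
  -- events increase to an occurrence at any non-positive time.
  set F : ℕ → Set (ℤ → S) := fun n => shift (-(n : ℤ)) ⁻¹' ⋃ l ≤ n, B l
  have hF : ∀ n ω, ω ∈ F n ↔ ∃ l : ℕ, l ≤ n ∧ shift (-(l : ℤ)) ω ∈ forward ⁻¹' A := by
    intro n ω
    simp only [F, B, Set.mem_preimage, Set.mem_iUnion, shift_shift, exists_prop]
    constructor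
    · rintro ⟨l, hl, h⟩
      refine ⟨n - l, by omega, ?_⟩
      rwa [show -((n - l : ℕ) : ℤ) = l + -n by omega]
    · rintro ⟨l, hl, h⟩
      refine ⟨n - l, by omega, ?_⟩
      rwa [show ((n - l : ℕ) : ℤ) + -n = -l by omega]
  have hFmono : Monotone F := by
    intro a b hab ω hω
    obtain ⟨l, hl, h⟩ := (hF a ω).1 hω
    exact (hF b ω).2 ⟨l, hl.trans hab, h⟩
  have hFunion : ⋃ n, F n = ⋃ l : ℕ, shift (-(l : ℤ)) ⁻¹' (forward ⁻¹' A) := by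
    ext ω
    simp only [Set.mem_iUnion, hF]
    exact ⟨fun ⟨n, l, _, h⟩ => ⟨l, h⟩, fun ⟨l, h⟩ => ⟨l, l, le_rfl, h⟩⟩
  set h := twoSidedLaw p m hm i (⋃ n, F n)
  have hν : twoSidedLawOf p m hm ν (⋃ n, F n) = h := by
    rw [twoSidedLawOf, Measure.sum_apply _
      (MeasurableSet.iUnion fun n => measurable_shift _ (hE n))]
    have : ∀ j, (ν j • twoSidedLaw p m hm j) (⋃ n, F n) = ν j * h := by
      intro j
      rw [Measure.smul_apply, smul_eq_mul, hFunion,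
        twoSidedLaw_past_eq p m hm i hirr hrec hA hAi j, ← hFunion]
    rw [tsum_congr this, ENNReal.tsum_mul_right, PMF.tsum_coe, one_mul]
  -- The window bound divided by `m i`: each `B l` has the measure of `A`, the capacity at `n`
  -- becomes `P_ν (F n)`, and the visits to `i` are bounded through `F n ⊆ ⋃ n, F n`.
  have hineq : ∀ k : ℕ, (k : ℝ≥0∞) * twoSidedLaw p m hm i (forward ⁻¹' A) +
      ∑ n ∈ Finset.range k, twoSidedLawOf p m hm ν (F n) ≤ k * h := by
    intro k
    have h1 := sum_measure_add_lintegral_le (stationaryLaw p m hm) i κ B hB k (by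
      intro ω l n hω hln _
      have : 0 < ∑ s ∈ Finset.range (n - l - 1 + 1), charge i κ (shift l ω s) := hω _
      rw [sum_range_shift] at this
      rwa [show l + (n - l - 1 + 1) = n by omega] at this)
    have e1 : ∀ l, stationaryLaw p m hm (B l) =
        m i * twoSidedLaw p m hm i (forward ⁻¹' A) := by
      intro l
      rw [← stationaryLaw_inter p m hm i hAm,
        Set.inter_eq_left.2 (show forward ⁻¹' A ⊆ {ω : ℤ → S | ω 0 = i} from fun ω hω => hAi hω)]
      exact (measurePreserving_shift p m hm l).measure_preimage hAm.nullMeasurableSet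
    have e2 : ∀ n : ℕ, ∫⁻ ω in ⋃ l ≤ n, B l, (κ (ω n) : ℝ≥0∞) ∂stationaryLaw p m hm =
        m i * twoSidedLawOf p m hm ν (F n) := fun n =>
      (mul_twoSidedLawOf p m hm i ν κ hκ n (hE n)).symm
    have e3 : ∀ n : ℕ, stationaryLaw p m hm ((⋃ l ≤ n, B l) ∩ {ω | ω n = i}) ≤ m i * h := by
      intro n
      rw [stationaryLaw_inter_coord p m hm i n (hE n)]
      exact mul_le_mul_right (measure_mono (Set.subset_iUnion F n)) _
    simp_rw [e1, e2] at h1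
    have h2 := h1.trans (Finset.sum_le_sum fun n _ => e3 n)
    rw [Finset.sum_const, Finset.sum_const, Finset.card_range, nsmul_eq_mul, nsmul_eq_mul,
      ← Finset.mul_sum, mul_left_comm, mul_left_comm _ _ h, ← mul_add] at h2
    exact (ENNReal.mul_le_mul_iff_right (by exact_mod_cast (hm.pos i).ne')
      ENNReal.coe_ne_top).1 h2
  have htend : Filter.Tendsto (fun n => (twoSidedLawOf p m hm ν).real (F n)) Filter.atTop
      (nhds h.toReal) := by
    rw [← hν]
    exact (ENNReal.tendsto_toReal (measure_ne_top _ _)).comp (tendsto_measure_iUnion_atTop hFmono)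
  have hreal : ∀ᶠ k : ℕ in Filter.atTop, (twoSidedLaw p m hm i).real (forward ⁻¹' A) +
      (k : ℝ)⁻¹ * ∑ n ∈ Finset.range k, (twoSidedLawOf p m hm ν).real (F n) ≤ h.toReal := by
    filter_upwards [Filter.eventually_gt_atTop 0] with k hk
    have hk' : (0 : ℝ) < k := by exact_mod_cast hk
    have h1 := ENNReal.toReal_mono (ENNReal.mul_ne_top (by simp) (measure_ne_top _ _)) (hineq k)
    rw [ENNReal.toReal_add (ENNReal.mul_ne_top (by simp) (measure_ne_top _ _)) (by simp),
      ENNReal.toReal_sum (by simp), ENNReal.toReal_mul, ENNReal.toReal_mul,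
      ENNReal.toReal_natCast] at h1
    simp only [← measureReal_def] at h1
    have h2 := mul_le_mul_of_nonneg_left h1 (inv_nonneg.2 hk'.le)
    rwa [mul_add, inv_mul_cancel_left₀ hk'.ne', inv_mul_cancel_left₀ hk'.ne'] at h2
  -- The Cesàro means of `P_ν (F n)` tend to `h`, so the limit reads `P_i(A) + h ≤ h` with `h`
  -- finite.
  have hlim := le_of_tendsto (tendsto_const_nhds.add htend.cesaro) hreal
  have h0 : (twoSidedLaw p m hm i).real (forward ⁻¹' A) = 0 :=
    le_antisymm (by linarith) measureReal_nonneg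
  rwa [measureReal_eq_zero_iff] at h0

end Recurrence

/-! ### From local times to charges -/

section LocalTime

variable {S : Type*} (m : S → ℝ≥0)

open scoped Classical in
lemma localTime_Icc (ω : ℤ → S) (j : S) (n : ℕ) :
    localTime m ω j (Set.Icc 0 (n : ℤ)) =
      ∑ r ∈ Finset.range (n + 1), if ω r = j then (m j : ℝ≥0∞)⁻¹ else 0 := by
  have : Set.Icc 0 (n : ℤ) ∩ {r | ω r = j} =
      (((Finset.range (n + 1)).filter fun r : ℕ => ω r = j).map Nat.castEmbedding :
        Finset ℤ) := by
    ext r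
    simp only [Set.mem_inter_iff, Set.mem_Icc, Set.mem_ofPred_eq, Finset.coe_map,
      Nat.castEmbedding_apply, Set.mem_image, Finset.mem_coe, Finset.mem_filter, Finset.mem_range]
    constructor
    · rintro ⟨⟨h1, h2⟩, h3⟩
      lift r to ℕ using h1
      exact ⟨r, ⟨by omega, h3⟩, rfl⟩
    · rintro ⟨r, ⟨h1, h2⟩, rfl⟩
      exact ⟨⟨by omega, by omega⟩, h2⟩
  rw [localTime, this, Set.encard_coe_eq_coe_finsetCard, Finset.card_map, ← Finset.sum_filter,
    Finset.sum_const, nsmul_eq_mul, div_eq_mul_inv]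
  simp

variable {m} {i : S} {ν : PMF S} {κ : S → ℕ}

/-- After multiplication by `m i`, each visit to `i` counts `1` on the left, and each visit to `j`
counts `m i * ν j / m j = κ j` on the right. -/
lemma localTime_le_iff_sum_charge_nonpos (hm : ∀ j, 0 < m j)
    (hκ : ∀ j, (m i : ℝ≥0∞) * ν j = m j * κ j) (ω : ℤ → S) (n : ℕ) :
    localTime m ω i (Set.Icc 0 (n : ℤ)) ≤ ∑' j, ν j * localTime m ω j (Set.Icc 0 (n : ℤ)) ↔
      ∑ r ∈ Finset.range (n + 1), charge i κ (ω r) ≤ 0 := by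
  classical
  have hm0 : ∀ j, (m j : ℝ≥0∞) ≠ 0 := fun j => by exact_mod_cast (hm j).ne'
  have h1 : (m i : ℝ≥0∞) * localTime m ω i (Set.Icc 0 (n : ℤ)) =
      ((∑ r ∈ Finset.range (n + 1), if ω r = i then 1 else 0 : ℕ) : ℝ≥0∞) := by
    rw [localTime_Icc, Finset.mul_sum]
    push_cast
    refine Finset.sum_congr rfl fun r _ => ?_
    split_ifs
    · exact ENNReal.mul_inv_cancel (hm0 i) ENNReal.coe_ne_top
    · simp
  have h2 : (m i : ℝ≥0∞) * ∑' j, ν j * localTime m ω j (Set.Icc 0 (n : ℤ)) =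
      ((∑ r ∈ Finset.range (n + 1), κ (ω r) : ℕ) : ℝ≥0∞) := by
    simp_rw [localTime_Icc, Finset.mul_sum]
    rw [Summable.tsum_finsetSum fun _ _ => ENNReal.summable, Finset.mul_sum]
    push_cast
    refine Finset.sum_congr rfl fun r _ => ?_
    rw [tsum_eq_single (ω r) fun j hj => by rw [if_neg hj.symm, mul_zero], if_pos rfl, ← mul_assoc,
      hκ, mul_right_comm, ENNReal.mul_inv_cancel (hm0 _) ENNReal.coe_ne_top, one_mul]
  rw [← ENNReal.mul_le_mul_iff_right (hm0 i) ENNReal.coe_ne_top, h1, h2, Nat.cast_le,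
    ← Nat.cast_le (α := ℤ)]
  simp only [charge, Finset.sum_sub_distrib]
  push_cast
  rw [sub_nonpos]

lemma lt_Tstar_iff_mem_survival (hm : ∀ j, 0 < m j) (hκ : ∀ j, (m i : ℝ≥0∞) * ν j = m j * κ j)
    (ω : ℤ → S) (r : ℕ) : (r : ℕ∞) < Tstar m i ν ω ↔ ω ∈ survival (charge i κ) r := by
  constructor
  · intro h n hn
    by_contra hneg
    refine absurd h (not_lt.2 (le_trans (sInf_le ⟨n, ?_, rfl⟩) (Nat.cast_le.2 hn)))
    exact (localTime_le_iff_sum_charge_nonpos hm hκ ω n).2 (not_lt.1 hneg)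
  · intro h
    rw [← ENat.add_one_le_iff (ENat.natCast_ne_top r)]
    refine le_sInf ?_
    rintro _ ⟨n, hn, rfl⟩
    have hn' := (localTime_le_iff_sum_charge_nonpos hm hκ ω n).1 hn
    have : r < n := not_le.1 fun hle => absurd (h n hle) (not_lt.2 hn')
    change (r : ℕ∞) + 1 ≤ (n : ℕ∞)
    exact_mod_cast this

lemma Tstar_eq_top_iff (hm : ∀ j, 0 < m j) (hκ : ∀ j, (m i : ℝ≥0∞) * ν j = m j * κ j)
    (ω : ℤ → S) : Tstar m i ν ω = ⊤ ↔ ω ∈ ⋂ r, survival (charge i κ) r := by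
  simp only [Set.mem_iInter, ← lt_Tstar_iff_mem_survival hm hκ]
  exact ENat.eq_top_iff_forall_gt

/-- `ENat.toNat` sends `⊤` to `0`, hence the set where the time is infinite has to be removed. -/
lemma lt_toNat_Tstar_iff (hm : ∀ j, 0 < m j) (hκ : ∀ j, (m i : ℝ≥0∞) * ν j = m j * κ j)
    (ω : ℤ → S) (r : ℕ) : r < (Tstar m i ν ω).toNat ↔
      ω ∈ survival (charge i κ) r \ ⋂ r, survival (charge i κ) r := by
  rw [Set.mem_sdiff, ← Tstar_eq_top_iff hm hκ, ← lt_Tstar_iff_mem_survival hm hκ]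
  by_cases h : Tstar m i ν ω = ⊤
  · simp [h]
  · rw [← ENat.natCast_lt_natCast, ENat.natCast_toNat h]
    simp [h]

lemma measurable_toNat_Tstar [MeasurableSpace S] [DiscreteMeasurableSpace S] (hm : ∀ j, 0 < m j)
    (hκ : ∀ j, (m i : ℝ≥0∞) * ν j = m j * κ j) :
    Measurable fun ω : ℤ → S => (Tstar m i ν ω).toNat := by
  refine measurable_of_Ioi fun r => ?_
  have : (fun ω : ℤ → S => (Tstar m i ν ω).toNat) ⁻¹' Set.Ioi r =
      survival (charge i κ) r \ ⋂ r, survival (charge i κ) r := by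
    ext ω
    exact lt_toNat_Tstar_iff hm hκ ω r
  rw [this]
  exact (measurableSet_survival _ r).diff (MeasurableSet.iInter (measurableSet_survival _))

/-- The integrality assumption enters here. The quotients are non-negative, so passing from `ℤ` to
`ℕ` by `toNat` loses nothing. -/
lemma exists_capacity (hm : ∀ j, 0 < m j)
    (hν : ∀ j, ∃ k : ℤ, (m i : ℝ) / m j * (ν j).toReal = k) :
    ∃ κ : S → ℕ, ∀ j, (m i : ℝ≥0∞) * ν j = m j * κ j := by
  choose k hk using hν
  refine ⟨fun j => (k j).toNat, fun j => ?_⟩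
  have hmj : (0 : ℝ) < m j := by exact_mod_cast hm j
  have hk0 : 0 ≤ k j := by
    have : (0 : ℝ) ≤ k j := by
      rw [← hk]
      positivity
    exact_mod_cast this
  have hkr : (((k j).toNat : ℕ) : ℝ) = k j := by
    exact_mod_cast congrArg (Int.cast (R := ℝ)) (Int.toNat_of_nonneg hk0)
  rw [← ENNReal.toReal_eq_toReal_iff'
    (ENNReal.mul_ne_top ENNReal.coe_ne_top (PMF.apply_ne_top ν j))
    (ENNReal.mul_ne_top ENNReal.coe_ne_top (ENNReal.natCast_ne_top _)), ENNReal.toReal_mul,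
    ENNReal.toReal_mul, ENNReal.toReal_natCast, hkr, ← hk]
  simp only [ENNReal.coe_toReal]
  field_simp

end LocalTime

end TwoSidedChain

/-! ### The theorem -/

open TwoSidedChain in
theorem theorem4 {S : Type*} [Countable S] [MeasurableSpace S] [DiscreteMeasurableSpace S]
    (p : S → PMF S) (hirr : IsIrreducible p) (hrec : IsRecurrent p)
    (m : S → ℝ≥0) (hm : IsStationary p m)
    (i : S) (ν : PMF S) (hνi : ν i = 0)
    (hν : ∀ j, ∃ k : ℤ, (m i : ℝ) / m j * (ν j).toReal = k) :
    (∀ᵐ ω ∂(twoSidedLaw p m hm i), Tstar m i ν ω ≠ ⊤) ∧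
    ∀ (Ω : Type*) [MeasurableSpace Ω] (Q : Kernel (ℤ → S) Ω) [IsMarkovKernel Q]
      (T : (ℤ → S) × Ω → ℕ), IsEmbedding p m hm i ν Q (fun z => (T z : ℤ)) →
      ∀ ψ : ℕ → ℝ, (∀ n, 0 ≤ ψ n) → IsConcave ψ →
        ∫⁻ ω, ENNReal.ofReal (ψ (Tstar m i ν ω).toNat) ∂(twoSidedLaw p m hm i) ≤
          ∫⁻ z, ENNReal.ofReal (ψ (T z)) ∂(extendedLaw p m hm i Q) := by
  obtain ⟨κ, hκ⟩ := exists_capacity hm.pos hν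
  have h0 := twoSidedLaw_iInter_survival p m hm i hirr hrec ν κ hκ
  refine ⟨?_, fun Ω _ Q _ T hT ψ hψ0 hψ => ?_⟩
  · filter_upwards [measure_eq_zero_iff_ae_notMem.1 h0] with ω hω htop
    exact hω ((Tstar_eq_top_iff hm.pos hκ ω).1 htop)
  · have hTm : Measurable T := by
      have h := (Measurable.of_discrete (f := Int.toNat)).comp hT.measurable
      simpa [Function.comp_def] using h
    refine lintegral_concave_le _ _ (measurable_toNat_Tstar hm.pos hκ) hTm (fun k => ?_) hψ0 hψ
    -- Only one inclusion is needed: where `(Tstar m i ν ω).toNat` exceeds `r`, the charge survives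
    -- up to `r`.
    refine le_trans (Finset.sum_le_sum fun r _ => measure_mono fun ω hω => ?_)
      (sum_survival_le p m hm i ν κ hκ Q T hT k)
    exact ((lt_toNat_Tstar_iff hm.pos hκ ω r).1 hω).1
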